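/- Let $\mathbb{F}$ be a field of characteristic zero, let $\mathfrak{g}$ be a Lie algebra over $\mathbb{F}$ (of any dimension), and let $\mathfrak{g} = \mathfrak{g}^- \oplus \mathfrak{g}^+$ be a decomposition into vector subspaces (which need not be subalgebras). Let $s, t$ be commuting formal variables that commute with $\mathfrak{g}$, let $\mathfrak{g}[[s,t]]$ be the Lie algebra of formal power series in $s, t$ with coefficients in $\mathfrak{g}$, and let $\pi^{\pm} : \mathfrak{g}[[s,t]] \to \mathfrak{g}^{\pm}[[s,t]]$ be the (coefficientwise) projections for the decomposition $\mathfrak{g}[[s,t]] = \mathfrak{g}^-[[s,t]] \oplus \mathfrak{g}^+[[s,t]]$. Exponentials of elements of $\mathfrak{g}[[s,t]]$ without constant term are formed in the algebra $U(\mathfrak{g})[[s,t]]$ of formal power series over the universal enveloping algebra $U(\mathfrak{g})$. Then there is a unique bijection $$\Psi : t\mathfrak{g}^+[[s,t]] \times s\mathfrak{g}^-[[s,t]] \longrightarrow s\mathfrak{g}^-[[s,t]] \times t\mathfrak{g}^+[[s,t]]$$ such that, for all $g^{\pm} \in \mathfrak{g}^{\pm}[[s,t]]$, writing $\Psi(tg^+,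 sg^-) = (s\Psi^-, t\Psi^+)$ with $\Psi^{\pm} \in \mathfrak{g}^{\pm}[[s,t]]$, $$e^{tg^+} e^{sg^-} = e^{s\Psi^-} e^{t\Psi^+}.$$ It is moreover the only map, bijective or not, with this property. Its terms of lowest order are described as follows: for all $g^{\pm} \in \mathfrak{g}^{\pm}[[s,t]]$, $$\Psi^- = g^- + t\,\pi^-([g^+, g^-]) + t\,\mathcal{P}^-(s,t), \qquad \Psi^+ = g^+ + s\,\pi^+([g^+, g^-]) + s\,\mathcal{P}^+(s,t),$$ where $\mathcal{P}^{\pm}(s,t) \in \mathfrak{g}^{\pm}[[s,t]]$ and $\mathcal{P}^{\pm}(0,0) = 0$. -/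

import Mathlib

noncomputable section

/-- For a vector space `V`, the space `V[[s,t]]` of formal power series in two commuting variables
with coefficients in `V`: a series `f` has the coefficient `f d` at `s ^ (d 0) * t ^ (d 1)`. -/
abbrev BiSeries (V : Type*) := MvPowerSeries (Fin 2) V

namespace BiSeries

/-- Multiplication of a series in `V[[s,t]]` by one of the two variables:
by `s` for `i = 0`, by `t` for `i = 1`. -/
def mulVar (F : Type*) [Field F] {V : Type*} [AddCommGroup V] [Module F V] (i : Fin 2) :
    BiSeries V →ₗ[F] BiSeries V where
  toFun f := fun d => if d i = 0 then 0 else f (d - Finsupp.single i 1)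
  map_add' f g := by
    funext d
    change (if d i = 0 then (0 : V) else f _ + g _) =
      (if d i = 0 then (0 : V) else f _) + (if d i = 0 then (0 : V) else g _)
    split_ifs <;> simp
  map_smul' c f := by
    funext d
    change (if d i = 0 then (0 : V) else c • f _) = c • (if d i = 0 then (0 : V) else f _)
    split_ifs <;> simp

/-- Multiplication by `s`. -/
abbrev sMul (F : Type*) [Field F] {V : Type*} [AddCommGroup V] [Module F V] :
    BiSeries V →ₗ[F] BiSeries V := mulVar F 0

/-- Multiplication by `t`. -/
abbrev tMul (F : Type*) [Field F] {V : Type*} [AddCommGroup V] [Module F V] :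
    BiSeries V →ₗ[F] BiSeries V := mulVar F 1

/-- The subspace `W[[s,t]]` of `V[[s,t]]`, for a subspace `W` of `V`. -/
def inside {F : Type*} [Field F] {V : Type*} [AddCommGroup V] [Module F V]
    (W : Submodule F V) : Submodule F (BiSeries V) where
  carrier := {f | ∀ d, f d ∈ W}
  add_mem' hf hg d := W.add_mem (hf d) (hg d)
  zero_mem' _ := W.zero_mem
  smul_mem' c _ hf d := W.smul_mem c (hf d)

/-- The subspace `s W[[s,t]]` of `V[[s,t]]`. -/
def sInside {F : Type*} [Field F] {V : Type*} [AddCommGroup V] [Module F V]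
    (W : Submodule F V) : Submodule F (BiSeries V) := (inside W).map (sMul F)

/-- The subspace `t W[[s,t]]` of `V[[s,t]]`. -/
def tInside {F : Type*} [Field F] {V : Type*} [AddCommGroup V] [Module F V]
    (W : Submodule F V) : Submodule F (BiSeries V) := (inside W).map (tMul F)

/-- A map `φ` applied to each coefficient of a series. -/
def mapCoeff {V W : Type*} (φ : V → W) (f : BiSeries V) : BiSeries W :=
  fun d => φ (f d)

/-- The Lie bracket of `𝔤[[s,t]]`, for which `s` and `t` commute with `𝔤`: the bracket of
`∑ aᵢ x ^ i` and `∑ bⱼ x ^ j` is `∑ ⁅aᵢ, bⱼ⁆ x ^ (i + j)`. -/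
def bracket {L : Type*} [LieRing L] (a b : BiSeries L) : BiSeries L :=
  fun d => ∑ p ∈ Finset.HasAntidiagonal.antidiagonal d, ⁅a p.1, b p.2⁆

/-- The formal exponential `∑ₙ xⁿ / n!` of a series `x` without constant term over an associative
algebra. Then `xⁿ` has no terms of total degree below `n`, so that the sum for the coefficient
at `d` may stop at the total degree of `d`: see `coeff_exp`. -/
def exp (F : Type*) [Field F] {A : Type*} [Ring A] [Algebra F A] (x : BiSeries A) : BiSeries A :=
  fun d => ∑ n ∈ Finset.range (d.degree + 1),
    ((n.factorial : F)⁻¹) • MvPowerSeries.coeff d (x ^ n)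

/-- Each coefficient of `exp` is that of all sufficiently long partial sums of `∑ₙ xⁿ / n!`. -/
theorem coeff_exp (F : Type*) [Field F] {A : Type*} [Ring A] [Algebra F A] (x : BiSeries A)
    (hx : MvPowerSeries.constantCoeff x = 0) (d : Fin 2 →₀ ℕ) (N : ℕ) (hN : d.degree < N) :
    MvPowerSeries.coeff d (exp F x) =
      MvPowerSeries.coeff d (∑ n ∈ Finset.range N, ((n.factorial : F)⁻¹) • x ^ n) := by
  rw [map_sum]
  change ∑ n ∈ Finset.range (d.degree + 1), ((n.factorial : F)⁻¹) • MvPowerSeries.coeff d (x ^ n) =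
    ∑ n ∈ Finset.range N, ((n.factorial : F)⁻¹) • MvPowerSeries.coeff d (x ^ n)
  refine Finset.sum_subset (Finset.range_mono hN) fun n _ hn => ?_
  rw [MvPowerSeries.coeff_of_lt_order, smul_zero]
  refine lt_of_lt_of_le ?_ (MvPowerSeries.le_order_pow_of_constantCoeff_eq_zero n hx)
  rw [Finset.mem_range, not_lt] at hn
  exact_mod_cast hn

/-- For a series `x` in `𝔤[[s,t]]` without constant term, the exponential `e ^ x` in
`U(𝔤)[[s,t]]`, where `U(𝔤)` is the universal enveloping algebra. -/
def lieExp (F : Type*) [Field F] {L : Type*} [LieRing L] [LieAlgebra F L] (x : BiSeries L) :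
    BiSeries (UniversalEnvelopingAlgebra F L) :=
  exp F (mapCoeff (UniversalEnvelopingAlgebra.ι F) x)

end BiSeries

end

/-! The factors are found degree by degree in s and t, with the logarithmic derivative in place of a
Baker-Campbell-Hausdorff formula. Let E be the Euler derivation. Since E(e^x) = e^x · ((1 - e^(-ad
x)) / ad x)(E x), the product W = e^x e^y satisfies E(W) = W · ω with ω = e^(-ad y)(ω_x) + ω_y,
where ω_x and ω_y belong to e^x and e^y. This ω (`logDerivMul`) is built from E and brackets alone,
so it is a series over 𝔤 itself. In characteristic zero, W and ω determine each other
(`exp_mul_exp_eq_iff`). As 𝔤 embeds in U(𝔤), the equation e^x e^y = e^a e^b becomes an equation in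
𝔤[[s,t]] (`lieExp_mul_lieExp_eq_iff`).

The coefficient of ω at d for e^a e^b is deg d · (a_d + b_d) plus terms in coefficients of lower
degree (`logDerivMul_sub_congr`). When a and b have coefficients in complementary subspaces, a_d and
b_d are recovered from their sum by projection. Hence a factorization exists and is unique, for
either order of the subspaces. Setting s = 0 or t = 0 and using uniqueness shows that the factors
are divisible by the right variables (`exists_lieExp_swap`). The two orders give mutually inverse
maps, and the coefficient at st gives the terms of lowest order (`lieExp_swap_apply`).

The embedding 𝔤 → U(𝔤) follows from a faithful representation of 𝔤 by vector fields on its formal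
group, whose 𝔤-valued functions are modelled by their iterated derivatives (`WordFun`). The
logarithm z is constructed from ((1 - e^(-ad z)) / ad z)(∂_c z) = c. The Maurer-Cartan equation
shows that the ∂_c obey the bracket relations of 𝔤 at z (`log_mem_repr`), and ∂_c z has the value c
at the identity, so no nonzero c acts as zero. -/

section

open Finset

/-! ### Fixed points of degree-raising maps -/

section Contraction

variable {I W : Type*} [Zero W]

/-- In a space of functions graded by `deg`, a map that improves agreement by one degree has a fixed
point. -/
theorem exists_fixedPoint_of_contracting (deg : I → ℕ) (Φ : (I → W) → I → W)
    (h0 : ∀ f, (∀ i, deg i = 0 → f i = 0) → ∀ i, deg i = 0 → Φ f i = 0)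
    (hΦ : ∀ n f g, (∀ i, deg i = 0 → f i = 0) → (∀ i, deg i = 0 → g i = 0) →
      (∀ i, deg i < n → f i = g i) → ∀ i, deg i < n + 1 → Φ f i = Φ g i) :
    ∃ f, (∀ i, deg i = 0 → f i = 0) ∧ Φ f = f := by
  have hs0 : ∀ n i, deg i = 0 → (Φ^[n] 0) i = 0 := by
    intro n
    induction n with
    | zero => intro i _; rfl
    | succ n ih => rw [Function.iterate_succ_apply']; exact h0 _ ih
  have hs : ∀ n i, deg i < n → (Φ^[n] 0) i = (Φ^[n + 1] 0) i := by
    intro n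
    induction n with
    | zero => intro i hi; omega
    | succ n ih =>
      rw [Function.iterate_succ_apply', Function.iterate_succ_apply' Φ (n + 1)]
      exact hΦ n _ _ (hs0 _) (hs0 _) ih
  have hs' : ∀ k n i, deg i < n → (Φ^[n] 0) i = (Φ^[n + k] 0) i := by
    intro k
    induction k with
    | zero => intro n i _; rfl
    | succ k ih => intro n i hi; rw [ih n i hi, hs (n + k) i (by omega), add_assoc]
  have hf : ∀ n i, deg i < n → (Φ^[deg i + 1] 0) i = (Φ^[n] 0) i := by
    intro n i hi
    obtain ⟨k, rfl⟩ := Nat.exists_eq_add_of_le (Nat.succ_le_of_lt hi)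
    exact hs' k _ i (Nat.lt_succ_self _)
  -- The value at `i` no longer changes from the iterate `deg i + 1` on.
  refine ⟨fun i => (Φ^[deg i + 1] 0) i, fun i hi => hs0 _ i hi, funext fun i => ?_⟩
  rw [hΦ (deg i) (fun i => (Φ^[deg i + 1] 0) i) (Φ^[deg i] 0) (fun i hi => hs0 _ i hi) (hs0 _)
    (hf (deg i)) i (Nat.lt_succ_self _), ← Function.iterate_succ_apply' Φ]

end Contraction

/-- Products of truncated series run over a square of indices; the terms beyond the triangle vanish
for reasons of order. -/
theorem sum_range_sum_range_eq_sum_antidiagonal {M : Type*} [AddCommMonoid M] (h : ℕ → ℕ → M)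
    (N : ℕ) (h0 : ∀ i j, N ≤ i + j → h i j = 0) :
    ∑ i ∈ range N, ∑ j ∈ range N, h i j =
      ∑ n ∈ range N, ∑ p ∈ antidiagonal n, h p.1 p.2 := by
  simp_rw [Finset.Nat.sum_antidiagonal_eq_sum_range_succ h]
  rw [Finset.sum_range_diag_flip]
  refine sum_congr rfl fun i hi => (sum_subset (range_mono (Nat.sub_le _ _)) ?_).symm
  intro j _ hj
  rw [mem_range] at hi hj
  exact h0 _ _ (by omega)

/-! ### The Maurer-Cartan identity, term by term -/

section MaurerCartan

variable {F : Type*} [Field F] [CharZero F] {H : Type*} [LieRing H] [LieAlgebra F H]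

/-- The coefficients of the series `(1 - e ^ (-x)) / x`. -/
def logCoeff (F : Type*) [Field F] (k : ℕ) : F := (-1) ^ k * ((k + 1).factorial : F)⁻¹

/-- The coefficients of the series `e ^ (-x)`. -/
def expNegCoeff (F : Type*) [Field F] (k : ℕ) : F := (-1) ^ k * (k.factorial : F)⁻¹

theorem logCoeff_zero (F : Type*) [Field F] : logCoeff F 0 = 1 := by simp [logCoeff]

theorem expNegCoeff_zero (F : Type*) [Field F] : expNegCoeff F 0 = 1 := by simp [expNegCoeff]

theorem logCoeff_succ (k : ℕ) : ((k : F) + 2) * logCoeff F (k + 1) = - logCoeff F k := by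
  have h1 : ((k : F) + 2) ≠ 0 := by exact_mod_cast (Nat.succ_ne_zero (k + 1))
  have h2 : ((k + 1).factorial : F) ≠ 0 := by exact_mod_cast Nat.factorial_ne_zero _
  rw [logCoeff, logCoeff, Nat.factorial_succ (k + 1)]
  push_cast
  rw [show (k : F) + 1 + 1 = k + 2 by ring]
  field_simp
  ring

theorem expNegCoeff_succ (k : ℕ) : ((k : F) + 1) * expNegCoeff F (k + 1) = - expNegCoeff F k := by
  have h1 : ((k : F) + 1) ≠ 0 := by exact_mod_cast (Nat.succ_ne_zero k)
  have h2 : (k.factorial : F) ≠ 0 := by exact_mod_cast Nat.factorial_ne_zero _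
  rw [expNegCoeff, expNegCoeff, Nat.factorial_succ k]
  push_cast
  field_simp
  ring

/-- Split the weight as n + 3 = (i + 1) + (j + 1) for i + j = n + 1. The recurrences turn each half
into brackets with `z`, apart from the boundary terms at i = 0 and j = 0, and the Leibniz rule
recombines the two halves. -/
theorem sum_antidiagonal_lie_of_recurrence {z x y : H} {p q : ℕ → H}
    (hp0 : p 0 = x) (hp : ∀ k : ℕ, ((k : F) + 2) • p (k + 1) = -⁅z, p k⁆)
    (hq0 : q 0 = y) (hq : ∀ k : ℕ, ((k : F) + 2) • q (k + 1) = -⁅z, q k⁆) (n : ℕ) :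
    ((n : F) + 3) • ∑ i ∈ antidiagonal (n + 1), ⁅p i.1, q i.2⁆ =
      ⁅x, q (n + 1)⁆ + ⁅p (n + 1), y⁆ - ⁅z, ∑ i ∈ antidiagonal n, ⁅p i.1, q i.2⁆⁆ := by
  have h1 : ((n : F) + 3) • ∑ i ∈ antidiagonal (n + 1), ⁅p i.1, q i.2⁆ =
      ∑ i ∈ antidiagonal (n + 1), ⁅((i.1 : F) + 1) • p i.1, q i.2⁆ +
      ∑ i ∈ antidiagonal (n + 1), ⁅p i.1, ((i.2 : F) + 1) • q i.2⁆ := by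
    rw [smul_sum, ← sum_add_distrib]
    refine sum_congr rfl fun i hi => ?_
    rw [HasAntidiagonal.mem_antidiagonal] at hi
    rw [smul_lie, lie_smul, ← add_smul]
    congr 1
    have : (i.1 : F) + i.2 = n + 1 := by exact_mod_cast hi
    linear_combination -this
  have h2 : ∀ k : ℕ, (((k + 1 : ℕ) : F) + 1) = (k : F) + 2 := fun k => by push_cast; ring
  rw [h1, Finset.Nat.sum_antidiagonal_succ, Finset.Nat.sum_antidiagonal_succ']
  simp only [h2, hp, hq, hp0, hq0, Nat.cast_zero, zero_add, one_smul, neg_lie, lie_neg,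
    sum_neg_distrib, lie_sum]
  rw [show ∑ i ∈ antidiagonal n, ⁅z, ⁅p i.1, q i.2⁆⁆ =
    ∑ i ∈ antidiagonal n, ⁅⁅z, p i.1⁆, q i.2⁆ + ∑ i ∈ antidiagonal n, ⁅p i.1, ⁅z, q i.2⁆⁆ by
      rw [← sum_add_distrib]; exact sum_congr rfl fun i _ => leibniz_lie _ _ _]
  abel

/-- The Maurer-Cartan equation for `e ^ (-z) X (e ^ z)`, term by term. -/
theorem maurerCartan_of_recurrence (X Y : H →ₗ[F] H)
    (hX : ∀ a b, X ⁅a, b⁆ = ⁅X a, b⁆ + ⁅a, X b⁆) (hY : ∀ a b, Y ⁅a, b⁆ = ⁅Y a, b⁆ + ⁅a, Y b⁆)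
    {z : H} {p q r : ℕ → H}
    (hp0 : p 0 = X z) (hp : ∀ k : ℕ, ((k : F) + 2) • p (k + 1) = -⁅z, p k⁆)
    (hq0 : q 0 = Y z) (hq : ∀ k : ℕ, ((k : F) + 2) • q (k + 1) = -⁅z, q k⁆)
    (hr0 : r 0 = X (Y z) - Y (X z)) (hr : ∀ k : ℕ, ((k : F) + 2) • r (k + 1) = -⁅z, r k⁆) (n : ℕ) :
    r (n + 1) = X (q (n + 1)) - Y (p (n + 1)) + ∑ i ∈ antidiagonal n, ⁅p i.1, q i.2⁆ := by
  induction n with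
  | zero =>
    have h2 : ((0 : ℕ) : F) + 2 ≠ 0 := by norm_num
    refine smul_right_injective H h2 ?_
    change (((0 : ℕ) : F) + 2) • _ = (((0 : ℕ) : F) + 2) • _
    rw [hr, smul_add, smul_sub, ← map_smul, ← map_smul, hq, hp, map_neg, map_neg, hX, hY, hr0, hp0,
      hq0]
    simp only [Nat.cast_zero, zero_add, Finset.Nat.antidiagonal_zero, sum_singleton, hp0, hq0, two_smul,
      lie_sub]
    rw [← lie_skew (Y z) (X z)]
    abel
  | succ n ih =>
    have h2 : ((n + 1 : ℕ) : F) + 2 ≠ 0 := by exact_mod_cast (Nat.succ_ne_zero (n + 2))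
    -- Multiplying by n + 3 makes the recurrences applicable to all three top terms.
    refine smul_right_injective H h2 ?_
    change (((n + 1 : ℕ) : F) + 2) • _ = (((n + 1 : ℕ) : F) + 2) • _
    rw [hr, smul_add, smul_sub, ← map_smul, ← map_smul, hq, hp, map_neg, map_neg, hX, hY,
      show (((n + 1 : ℕ) : F) + 2) = n + 3 by push_cast; ring,
      sum_antidiagonal_lie_of_recurrence hp0 hp hq0 hq n, ih, lie_add, lie_sub,
      ← lie_skew (Y z) (p (n + 1))]
    abel

end MaurerCartan

/-! ### The Lie algebra of formal functions -/

/-- Functions on words in a Lie algebra `L` with values in `L`. They model the functions on a formal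
group with Lie algebra `L` through their iterated derivatives at the identity. -/
def WordFun (L : Type*) := List L → L

namespace WordFun

@[ext] theorem ext {L : Type*} {f g : WordFun L} (h : ∀ w, f w = g w) : f = g := funext h

variable {L : Type*} [LieRing L]

instance : AddCommGroup (WordFun L) := inferInstanceAs (AddCommGroup (List L → L))

@[simp] theorem add_apply (f g : WordFun L) (w : List L) : (f + g) w = f w + g w := rfl
@[simp] theorem sub_apply (f g : WordFun L) (w : List L) : (f - g) w = f w - g w := rfl
@[simp] theorem zero_apply (w : List L) : (0 : WordFun L) w = 0 := rfl

/-- The derivative in the direction of a letter. -/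
def shift (c : L) (f : WordFun L) : WordFun L := fun w => f (c :: w)

/-- The bracket of functions, with respect to which each `shift c` is a derivation. -/
def lieAux : List L → WordFun L → WordFun L → L
  | [], f, g => ⁅f [], g []⁆
  | c :: w, f, g => lieAux w (shift c f) g + lieAux w f (shift c g)

theorem lieAux_add (w : List L) : ∀ f g h : WordFun L,
    lieAux w f (g + h) = lieAux w f g + lieAux w f h := by
  induction w with
  | nil => intro f g h; exact lie_add _ _ _
  | cons c w ih =>
    intro f g h
    change lieAux w _ _ + lieAux w f (shift c g + shift c h) = _
    rw [ih, ih]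
    change _ = lieAux w _ _ + _ + (lieAux w _ _ + _)
    abel

theorem add_lieAux (w : List L) : ∀ f g h : WordFun L,
    lieAux w (f + g) h = lieAux w f h + lieAux w g h := by
  induction w with
  | nil => intro f g h; exact add_lie _ _ _
  | cons c w ih =>
    intro f g h
    change lieAux w (shift c f + shift c g) h + lieAux w _ _ = _
    rw [ih, ih]
    change _ = lieAux w _ _ + _ + (lieAux w _ _ + _)
    abel

theorem lieAux_self (w : List L) : ∀ f g : WordFun L, lieAux w f g + lieAux w g f = 0 := by
  induction w with
  | nil =>
    intro f g
    change ⁅f [], g []⁆ + ⁅g [], f []⁆ = 0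
    rw [← lie_skew (f []) (g []), neg_add_cancel]
  | cons c w ih =>
    intro f g
    change lieAux w _ _ + lieAux w _ _ + (lieAux w _ _ + lieAux w _ _) = 0
    rw [add_comm (lieAux w (shift c g) f), add_add_add_comm, ih, ih, add_zero]

instance : Bracket (WordFun L) (WordFun L) := ⟨fun f g w => lieAux w f g⟩

theorem lie_nil (f g : WordFun L) : ⁅f, g⁆ [] = ⁅f [], g []⁆ := rfl

theorem lie_cons (f g : WordFun L) (c : L) (w : List L) :
    ⁅f, g⁆ (c :: w) = ⁅shift c f, g⁆ w + ⁅f, shift c g⁆ w := rfl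

theorem shift_lie' (f g : WordFun L) (c : L) :
    shift c ⁅f, g⁆ = ⁅shift c f, g⁆ + ⁅f, shift c g⁆ := rfl

/-- Each `shift c` is a derivation of the bracket, so the identity on `c :: w` is a sum of three
instances of the identity on `w`. -/
theorem leibniz_aux (w : List L) : ∀ f g h : WordFun L,
    ⁅f, ⁅g, h⁆⁆ w = ⁅⁅f, g⁆, h⁆ w + ⁅g, ⁅f, h⁆⁆ w := by
  have hadd : ∀ (w : List L) (f g h : WordFun L), ⁅f, g + h⁆ w = ⁅f, g⁆ w + ⁅f, h⁆ w := lieAux_add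
  have hadd' : ∀ (w : List L) (f g h : WordFun L), ⁅f + g, h⁆ w = ⁅f, h⁆ w + ⁅g, h⁆ w := add_lieAux
  induction w with
  | nil => intro f g h; exact leibniz_lie _ _ _
  | cons c w ih =>
    intro f g h
    rw [lie_cons f, lie_cons _ h, lie_cons g, shift_lie', shift_lie', shift_lie', hadd, hadd,
      hadd', ih (shift c f) g h, ih f (shift c g) h, ih f g (shift c h)]
    abel

instance : LieRing (WordFun L) where
  add_lie f g h := funext fun w => add_lieAux w f g h
  lie_add f g h := funext fun w => lieAux_add w f g h
  lie_self f := by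
    funext w
    change lieAux w f f = 0
    induction w generalizing f with
    | nil => exact lie_self _
    | cons c w ih => exact lieAux_self w _ _
  leibniz_lie f g h := funext fun w => leibniz_aux w f g h

variable {F : Type*} [Field F] [LieAlgebra F L]

instance : Module F (WordFun L) := inferInstanceAs (Module F (List L → L))

@[simp] theorem smul_apply (r : F) (f : WordFun L) (w : List L) : (r • f) w = r • f w := rfl

instance : LieAlgebra F (WordFun L) where
  lie_smul r f g := by
    funext w
    change ⁅f, r • g⁆ w = r • ⁅f, g⁆ w
    induction w generalizing f g with
    | nil => exact lie_smul _ _ _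
    | cons c w ih =>
      rw [lie_cons, lie_cons, smul_add, ih, ← ih f (shift c g)]
      rfl

@[simp] theorem sum_apply {ι : Type*} (s : Finset ι) (f : ι → WordFun L) (w : List L) :
    (∑ i ∈ s, f i) w = ∑ i ∈ s, f i w := Finset.sum_apply w s f

variable (F) in
/-- `shift c` as a linear map. -/
def deriv (c : L) : WordFun L →ₗ[F] WordFun L where
  toFun := shift c
  map_add' _ _ := rfl
  map_smul' _ _ := rfl

@[simp] theorem deriv_apply (c : L) (f : WordFun L) (w : List L) : deriv F c f w = f (c :: w) := rfl

theorem deriv_lie (c : L) (f g : WordFun L) :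
    deriv F c ⁅f, g⁆ = ⁅deriv F c f, g⁆ + ⁅f, deriv F c g⁆ := rfl

/-- The constant functions. -/
def const (c : L) : WordFun L
  | [] => c
  | _ :: _ => 0

theorem deriv_const (a c : L) : deriv F a (const c) = 0 := rfl

theorem const_lie_const (a b : L) : ⁅const a, const b⁆ = const ⁅a, b⁆ := by
  ext w
  cases w with
  | nil => rfl
  | cons c w =>
    rw [lie_cons]
    change ⁅(0 : WordFun L), const b⁆ w + ⁅const a, (0 : WordFun L)⁆ w = 0
    simp

variable (F) in
/-- The functions that vanish on the words of length less than `n`. -/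
def vanishing (n : ℕ) : Submodule F (WordFun L) where
  carrier := {f | ∀ w : List L, w.length < n → f w = 0}
  add_mem' hf hg w hw := by rw [add_apply, hf w hw, hg w hw, add_zero]
  zero_mem' _ _ := rfl
  smul_mem' r f hf w hw := by rw [smul_apply, hf w hw, smul_zero]

theorem vanishing_mono {m n : ℕ} (h : m ≤ n) {f : WordFun L} (hf : f ∈ vanishing F n) :
    f ∈ vanishing F m := fun w hw => hf w (by omega)

theorem mem_vanishing_zero (f : WordFun L) : f ∈ vanishing F 0 := fun _ hw => by omega

theorem deriv_mem_vanishing {n : ℕ} (c : L) {f : WordFun L} (hf : f ∈ vanishing F (n + 1)) :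
    deriv F c f ∈ vanishing F n := fun w hw => hf (c :: w) (by simpa using hw)

/-- Each letter differentiates one of the two functions; a word shorter than m + n leaves one of
them with too few letters. -/
theorem lie_mem_vanishing {m n k : ℕ} (hk : k ≤ m + n) {f g : WordFun L} (hf : f ∈ vanishing F m)
    (hg : g ∈ vanishing F n) : ⁅f, g⁆ ∈ vanishing F k := by
  intro w hw
  replace hw : w.length < m + n := by omega
  clear hk
  induction w generalizing m n f g with
  | nil =>
    rw [lie_nil]
    rcases Nat.eq_zero_or_pos m with rfl | hm
    · rw [hg [] (by simpa using hw), lie_zero]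
    · rw [hf [] hm, zero_lie]
  | cons c w ih =>
    rw [List.length_cons] at hw
    -- Truncated subtraction is harmless: if `m = 0`, the length bound alone decreases by one.
    have hd : ∀ {m} {f : WordFun L}, f ∈ vanishing F m → shift c f ∈ vanishing F (m - 1) :=
      fun {m} {f} hf v hv => hf (c :: v) (by rw [List.length_cons]; omega)
    rw [lie_cons, ih (hd hf) hg (by omega), ih hf (hd hg) (by omega), add_zero]

theorem eq_zero_of_forall_mem_vanishing {f : WordFun L} (h : ∀ n, f ∈ vanishing F n) : f = 0 :=
  ext fun w => h (w.length + 1) w (Nat.lt_succ_self _)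

/-! ### The logarithm -/

/-- The terms of `(1 - e ^ (-ad z)) / ad z` applied to `y`. -/
def logTerm (F : Type*) [Field F] [LieAlgebra F L] (z : WordFun L) (k : ℕ) :
    WordFun L →ₗ[F] WordFun L := logCoeff F k • LieAlgebra.ad F (WordFun L) z ^ k

theorem logTerm_zero (z y : WordFun L) : logTerm F z 0 y = y := by
  simp [logTerm, logCoeff_zero]

theorem logTerm_succ [CharZero F] (z y : WordFun L) (k : ℕ) :
    ((k : F) + 2) • logTerm F z (k + 1) y = -⁅z, logTerm F z k y⁆ := by
  rw [logTerm, LinearMap.smul_apply, smul_smul, logCoeff_succ, pow_succ', logTerm,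
    LinearMap.smul_apply, lie_smul, neg_smul]
  rfl

theorem ad_pow_mem_vanishing {z y : WordFun L} (hz : z ∈ vanishing F 1) {n : ℕ}
    (hy : y ∈ vanishing F n) (k : ℕ) :
    (LieAlgebra.ad F (WordFun L) z ^ k) y ∈ vanishing F (n + k) := by
  induction k with
  | zero => exact hy
  | succ k ih =>
    rw [pow_succ']
    exact lie_mem_vanishing (by omega) hz ih

theorem logTerm_mem_vanishing {z y : WordFun L} (hz : z ∈ vanishing F 1) {n : ℕ}
    (hy : y ∈ vanishing F n) (k : ℕ) : logTerm F z k y ∈ vanishing F (n + k) :=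
  Submodule.smul_mem _ _ (ad_pow_mem_vanishing hz hy k)

/-- An application of `ad z` with `z` of order one gains an order. The loss of one order in `y -
y'`, which will come from a derivative, is thus made good. -/
theorem ad_pow_congr {z z' : WordFun L} (hz' : z' ∈ vanishing F 1)
    {n : ℕ} (hzz : z - z' ∈ vanishing F n) {y y' : WordFun L}
    (hy : y - y' ∈ vanishing F (n - 1)) (k : ℕ) :
    (LieAlgebra.ad F (WordFun L) z ^ (k + 1)) y - (LieAlgebra.ad F (WordFun L) z' ^ (k + 1)) y' ∈
      vanishing F n := by
  have key : ∀ u u' : WordFun L, u - u' ∈ vanishing F (n - 1) → ⁅z, u⁆ - ⁅z', u'⁆ ∈ vanishing F n := by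
    intro u u' h
    rw [show ⁅z, u⁆ - ⁅z', u'⁆ = ⁅z - z', u⁆ + ⁅z', u - u'⁆ by rw [sub_lie, lie_sub]; abel]
    exact add_mem (lie_mem_vanishing (by omega) hzz (mem_vanishing_zero u))
      (lie_mem_vanishing (by omega) hz' h)
  induction k with
  | zero => simpa using key _ _ hy
  | succ k ih =>
    rw [pow_succ', pow_succ' _ (k + 1)]
    exact key _ _ (vanishing_mono (Nat.sub_le _ _) ih)

/-- The series is the identity plus operators that raise the order, so it is injective, with control
of the order. -/
theorem eq_zero_of_sum_logTerm {z y : WordFun L} (hz : z ∈ vanishing F 1) {M N : ℕ} (hM : 0 < M)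
    (h : ∑ k ∈ range M, logTerm F z k y ∈ vanishing F N) : y ∈ vanishing F N := by
  obtain ⟨M, rfl⟩ := Nat.exists_eq_add_of_le' hM
  rw [sum_range_succ', logTerm_zero] at h
  have key : ∀ n, n ≤ N → y ∈ vanishing F n := by
    intro n
    induction n with
    | zero => intro _; exact mem_vanishing_zero y
    | succ n ih =>
      intro hn
      have h2 : ∑ k ∈ range M, logTerm F z (k + 1) y ∈ vanishing F (n + 1) :=
        sum_mem fun k _ => vanishing_mono (by omega)
          (logTerm_mem_vanishing hz (ih (by omega)) (k + 1))
      simpa using sub_mem (vanishing_mono hn h) h2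
  exact key N le_rfl

/-- The logarithm: the function `z` with `(1 - e ^ (-ad z)) / ad z` applied to the derivative of `z`
in direction `c` equal to `c`. -/
theorem exists_log (F : Type*) [Field F] [LieAlgebra F L] : ∃ z : WordFun L, z ∈ vanishing F 1 ∧
    ∀ c N, ∑ k ∈ range (N + 1), logTerm F z k (deriv F c z) - const c ∈ vanishing F (N + 1) := by
  -- The defining equation solved for its term k = 0, which at `w` is `z (c :: w)`. Terms with k
  -- beyond the length of `w` vanish at `w`.
  let Φ : (List L → L) → List L → L := fun z w => match w with
    | [] => 0
    | c :: w => const c w - ∑ k ∈ range w.length, logTerm F z (k + 1) (deriv F c z) w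
  obtain ⟨(z : WordFun L), hz0, hz⟩ := exists_fixedPoint_of_contracting List.length Φ
    (fun f _ w hw => by rw [List.length_eq_zero_iff] at hw; subst hw; rfl) (by
      intro n f g hf hg hfg w hw
      cases w with
      | nil => rfl
      | cons c w =>
        change const c w - _ = const c w - _
        congr 1
        refine sum_congr rfl fun k _ => ?_
        have hg' : (g : WordFun L) ∈ vanishing F 1 := fun w hw => hg w (by omega)
        have hfg' : (f : WordFun L) - g ∈ vanishing F n := fun w hw => sub_eq_zero.2 (hfg w hw)
        have hd : deriv F c f - deriv F c g ∈ vanishing F (n - 1) := fun v hv =>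
          hfg' (c :: v) (by rw [List.length_cons]; omega)
        have := Submodule.smul_mem _ (logCoeff F (k + 1)) (ad_pow_congr hg' hfg' hd k) w
          (by rw [List.length_cons] at hw; omega)
        rw [smul_sub] at this
        exact sub_eq_zero.1 this)
  change WordFun L at z
  have hz1 : z ∈ vanishing F 1 := fun w hw => hz0 w (by omega)
  refine ⟨z, hz1, fun c N w hw => ?_⟩
  have h : z (c :: w) = const c w - ∑ k ∈ range w.length, logTerm F z (k + 1) (deriv F c z) w := by
    conv_lhs => rw [← hz]
  rw [sub_apply, sum_apply, sum_range_succ', logTerm_zero, deriv_apply, h,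
    ← sum_subset (range_mono (show w.length ≤ N by omega))]
  · abel
  · intro k _ hk
    rw [mem_range, not_lt] at hk
    exact logTerm_mem_vanishing (F := F) hz1 (mem_vanishing_zero _) (k + 1) w (by omega)

/-! ### Functions on which the derivatives represent the Lie algebra -/

variable (F) in
/-- The functions on which the derivatives `deriv F c` form a representation up to order `n`. -/
def repr : ℕ → Submodule F (WordFun L)
  | 0 => (⨅ a : L, ⨅ b : L, LinearMap.ker (deriv F (a + b) - deriv F a - deriv F b)) ⊓
      (⨅ r : F, ⨅ a : L, LinearMap.ker (deriv F (r • a) - r • deriv F a)) ⊓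
      (⨅ a : L, ⨅ b : L, LinearMap.ker
        (deriv F ⁅a, b⁆ - (deriv F a * deriv F b - deriv F b * deriv F a)))
  | n + 1 => repr 0 ⊓ ⨅ c : L, (repr n).comap (deriv F c)

theorem mem_repr_zero {f : WordFun L} : f ∈ repr F 0 ↔
    (∀ a b, deriv F (a + b) f = deriv F a f + deriv F b f) ∧
    (∀ (r : F) a, deriv F (r • a) f = r • deriv F a f) ∧
    ∀ a b, deriv F ⁅a, b⁆ f = deriv F a (deriv F b f) - deriv F b (deriv F a f) := by
  simp only [repr, Submodule.mem_inf, Submodule.mem_iInf, LinearMap.mem_ker, LinearMap.sub_apply,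
    LinearMap.add_apply, sub_eq_zero, sub_sub, LinearMap.smul_apply, Module.End.mul_apply, and_assoc]

theorem mem_repr_succ {n : ℕ} {f : WordFun L} : f ∈ repr F (n + 1) ↔
    f ∈ repr F 0 ∧ ∀ c, deriv F c f ∈ repr F n := by
  simp only [repr, Submodule.mem_inf, Submodule.mem_iInf, Submodule.mem_comap]

theorem repr_succ_le (n : ℕ) : (repr F (n + 1) : Submodule F (WordFun L)) ≤ repr F n := by
  induction n with
  | zero => exact fun f hf => (mem_repr_succ.1 hf).1
  | succ n ih =>
    intro f hf
    rw [mem_repr_succ] at hf ⊢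
    exact ⟨hf.1, fun c => ih (hf.2 c)⟩

/-- Derivatives act as derivations. In the commutator of two of them the mixed terms cancel. -/
theorem lie_mem_repr_zero {f g : WordFun L} (hf : f ∈ repr F 0) (hg : g ∈ repr F 0) :
    ⁅f, g⁆ ∈ repr F 0 := by
  rw [mem_repr_zero] at *
  obtain ⟨hf1, hf2, hf3⟩ := hf
  obtain ⟨hg1, hg2, hg3⟩ := hg
  refine ⟨fun a b => ?_, fun r a => ?_, fun a b => ?_⟩
  · rw [deriv_lie, deriv_lie, deriv_lie, hf1, hg1, add_lie, lie_add]
    abel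
  · rw [deriv_lie, deriv_lie, hf2, hg2, smul_lie, lie_smul, smul_add]
  · rw [deriv_lie, deriv_lie, deriv_lie, hf3, hg3, map_add, map_add, deriv_lie, deriv_lie,
      deriv_lie, deriv_lie, sub_lie, lie_sub]
    abel

theorem lie_mem_repr {n : ℕ} {f g : WordFun L} (hf : f ∈ repr F n) (hg : g ∈ repr F n) :
    ⁅f, g⁆ ∈ repr F n := by
  induction n generalizing f g with
  | zero => exact lie_mem_repr_zero hf hg
  | succ n ih =>
    have hf' := mem_repr_succ.1 hf
    have hg' := mem_repr_succ.1 hg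
    refine mem_repr_succ.2 ⟨lie_mem_repr_zero hf'.1 hg'.1, fun c => ?_⟩
    rw [deriv_lie]
    exact add_mem (ih (hf'.2 c) (repr_succ_le n hg)) (ih (repr_succ_le n hf) (hg'.2 c))

theorem const_mem_repr (c : L) (n : ℕ) : const c ∈ repr F n := by
  have h0 : const c ∈ repr F 0 := by
    rw [mem_repr_zero]
    simp [deriv_const]
  cases n with
  | zero => exact h0
  | succ n => exact mem_repr_succ.2 ⟨h0, fun a => by rw [deriv_const]; exact zero_mem _⟩

/-- The space is closed in the topology of orders, since every relation that defines it is
continuous. -/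
theorem mem_repr_of_approx {n : ℕ} {f : WordFun L}
    (h : ∀ N, ∃ g ∈ repr F n, f - g ∈ vanishing F N) : f ∈ repr F n := by
  have h0 : ∀ {f : WordFun L}, (∀ N, ∃ g ∈ repr F 0, f - g ∈ vanishing F N) → f ∈ repr F 0 := by
    intro f h
    rw [mem_repr_zero]
    -- The bracket relation has second derivatives, so it loses up to two orders.
    have key : ∀ T : WordFun L →ₗ[F] WordFun L, (∀ g ∈ repr F 0, T g = 0) →
        (∀ n, ∀ g ∈ vanishing F (n + 2), T g ∈ vanishing F n) → T f = 0 := by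
      intro T hT hT'
      refine eq_zero_of_forall_mem_vanishing (F := F) fun n => ?_
      obtain ⟨g, hg, hfg⟩ := h (n + 2)
      have := hT' n _ hfg
      rwa [map_sub, hT g hg, sub_zero] at this
    have hd : ∀ c n (g : WordFun L), g ∈ vanishing F (n + 2) → deriv F c g ∈ vanishing F n :=
      fun c n g hg => deriv_mem_vanishing c (vanishing_mono (Nat.le_succ _) hg)
    have hdd : ∀ c d n (g : WordFun L), g ∈ vanishing F (n + 2) →
        deriv F c (deriv F d g) ∈ vanishing F n :=
      fun c d n g hg => deriv_mem_vanishing c (deriv_mem_vanishing d hg)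
    refine ⟨fun a b => sub_eq_zero.1 ?_, fun r a => sub_eq_zero.1 ?_, fun a b => sub_eq_zero.1 ?_⟩
    · exact key (deriv F (a + b) - (deriv F a + deriv F b))
        (fun g hg => sub_eq_zero.2 ((mem_repr_zero.1 hg).1 a b))
        (fun n g hg => sub_mem (hd _ n g hg) (add_mem (hd _ n g hg) (hd _ n g hg)))
    · exact key (deriv F (r • a) - r • deriv F a)
        (fun g hg => sub_eq_zero.2 ((mem_repr_zero.1 hg).2.1 r a))
        (fun n g hg => sub_mem (hd _ n g hg) (Submodule.smul_mem _ _ (hd _ n g hg)))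
    · exact key (deriv F ⁅a, b⁆ - (deriv F a * deriv F b - deriv F b * deriv F a))
        (fun g hg => sub_eq_zero.2 ((mem_repr_zero.1 hg).2.2 a b))
        (fun n g hg => sub_mem (hd _ n g hg) (sub_mem (hdd _ _ n g hg) (hdd _ _ n g hg)))
  induction n generalizing f with
  | zero => exact h0 h
  | succ n ih =>
    refine mem_repr_succ.2 ⟨h0 fun N => ?_, fun c => ih fun N => ?_⟩
    · obtain ⟨g, hg, hfg⟩ := h N
      exact ⟨g, (mem_repr_succ.1 hg).1, hfg⟩
    · obtain ⟨g, hg, hfg⟩ := h (N + 1)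
      exact ⟨deriv F c g, (mem_repr_succ.1 hg).2 c, by
        rw [← map_sub]; exact deriv_mem_vanishing c hfg⟩

section Log

variable [CharZero F]

/-- Apply the injective operator (1 - e^(-ad z)) / ad z to both sides of each relation. For the
bracket relation, Maurer-Cartan turns the commutator side into ∂_a b - ∂_b a + ⁅a, b⁆ with constant
functions a and b, that is, into ⁅a, b⁆. -/
theorem log_mem_repr_zero {z : WordFun L} (hz : z ∈ vanishing F 1)
    (hzc : ∀ c N, ∑ k ∈ range (N + 1), logTerm F z k (deriv F c z) - const c ∈
      vanishing F (N + 1)) :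
    z ∈ repr F 0 := by
  have uniq : ∀ y : WordFun L, (∀ N, ∑ k ∈ range (N + 2), logTerm F z k y ∈ vanishing F (N + 1)) →
      y = 0 := fun y h => eq_zero_of_forall_mem_vanishing (F := F) fun n =>
    vanishing_mono (Nat.le_succ n) (eq_zero_of_sum_logTerm hz (by omega) (h n))
  have hzc' : ∀ c N, ∑ k ∈ range (N + 2), logTerm F z k (deriv F c z) - const c ∈
      vanishing F (N + 1) := fun c N => vanishing_mono (Nat.le_succ _) (hzc c (N + 1))
  rw [mem_repr_zero]
  refine ⟨fun a b => sub_eq_zero.1 (uniq _ fun N => ?_),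
    fun r a => sub_eq_zero.1 (uniq _ fun N => ?_), fun a b => sub_eq_zero.1 (uniq _ fun N => ?_)⟩
  · have h := sub_mem (hzc' (a + b) N) (add_mem (hzc' a N) (hzc' b N))
    have hc : const (a + b) = const a + const b := by
      ext w; cases w <;> simp [const]
    simp only [map_sub, map_add, sum_sub_distrib, sum_add_distrib]
    rw [hc] at h
    convert h using 1
    abel
  · have h := sub_mem (hzc' (r • a) N) (Submodule.smul_mem _ r (hzc' a N))
    have hc : const (r • a) = r • const a := by
      ext w; cases w <;> simp [const]
    simp only [map_sub, map_smul, sum_sub_distrib, ← smul_sum]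
    rw [hc, smul_sub] at h
    convert h using 1
    abel
  · have h1 := hzc' ⁅a, b⁆ N
    have hr := maurerCartan_of_recurrence (deriv F a) (deriv F b) (deriv_lie a) (deriv_lie b) (z := z)
      (p := fun k => logTerm F z k (deriv F a z)) (q := fun k => logTerm F z k (deriv F b z))
      (r := fun k => logTerm F z k (deriv F a (deriv F b z) - deriv F b (deriv F a z)))
      (logTerm_zero z _) (logTerm_succ z _) (logTerm_zero z _) (logTerm_succ z _)
      (logTerm_zero z _) (logTerm_succ (F := F) z _)
    have h2 : ∑ k ∈ range (N + 2), logTerm F z k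
          (deriv F a (deriv F b z) - deriv F b (deriv F a z)) =
        deriv F a (∑ k ∈ range (N + 2), logTerm F z k (deriv F b z)) -
        deriv F b (∑ k ∈ range (N + 2), logTerm F z k (deriv F a z)) +
        ∑ n ∈ range (N + 1), ∑ i ∈ antidiagonal n,
          ⁅logTerm F z i.1 (deriv F a z), logTerm F z i.2 (deriv F b z)⁆ := by
      simp only [sum_range_succ' _ (N + 1), hr, sum_add_distrib, sum_sub_distrib, map_add, map_sum,
        logTerm_zero]
      abel
    -- The derivative costs one order, hence the bound N + 1 for sums with N + 2 terms.
    have h3 : ∀ c d : L,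
        deriv F c (∑ k ∈ range (N + 2), logTerm F z k (deriv F d z)) ∈ vanishing F (N + 1) := by
      intro c d
      have := deriv_mem_vanishing c (hzc d (N + 1))
      rwa [map_sub, deriv_const, sub_zero] at this
    have h4 : ∑ n ∈ range (N + 1), ∑ i ∈ antidiagonal n,
          ⁅logTerm F z i.1 (deriv F a z), logTerm F z i.2 (deriv F b z)⁆ -
        ⁅∑ k ∈ range (N + 1), logTerm F z k (deriv F a z),
          ∑ k ∈ range (N + 1), logTerm F z k (deriv F b z)⁆ ∈ vanishing F (N + 1) := by
      intro w hw
      simp only [sub_apply, sum_apply, sub_eq_zero, sum_lie, lie_sum]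
      rw [eq_comm, sum_comm]
      refine sum_range_sum_range_eq_sum_antidiagonal
        (fun i j => (⁅logTerm F z i (deriv F a z), logTerm F z j (deriv F b z)⁆ : WordFun L) w) _
        fun i j hij => ?_
      exact lie_mem_vanishing (F := F) le_rfl (logTerm_mem_vanishing hz (mem_vanishing_zero _) i)
        (logTerm_mem_vanishing hz (mem_vanishing_zero _) j) w (by omega)
    have h5 : ⁅∑ k ∈ range (N + 1), logTerm F z k (deriv F a z),
          ∑ k ∈ range (N + 1), logTerm F z k (deriv F b z)⁆ - const ⁅a, b⁆ ∈
        vanishing F (N + 1) := by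
      have := add_mem (lie_mem_vanishing (k := N + 1) (by omega) (hzc a N)
        (mem_vanishing_zero (∑ k ∈ range (N + 1), logTerm F z k (deriv F b z))))
        (lie_mem_vanishing (k := N + 1) (by omega) (mem_vanishing_zero (const a)) (hzc b N))
      rw [sub_lie, lie_sub, const_lie_const] at this
      convert this using 1
      abel
    simp only [map_sub _ (deriv F ⁅a, b⁆ z), sum_sub_distrib]
    rw [h2]
    have h6 := sub_mem h1 (add_mem (sub_mem (h3 a b) (h3 b a)) (add_mem h4 h5))
    convert h6 using 1
    abel

/-- Once `z` satisfies the relations to order n, so does ∂_c z: it is a limit of expressions in `z`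
and constants, which the bracket keeps in `repr F n`. -/
theorem log_mem_repr {z : WordFun L} (hz : z ∈ vanishing F 1)
    (hzc : ∀ c N, ∑ k ∈ range (N + 1), logTerm F z k (deriv F c z) - const c ∈
      vanishing F (N + 1)) (n : ℕ) :
    z ∈ repr F n := by
  have h0 := log_mem_repr_zero hz hzc
  induction n with
  | zero => exact h0
  | succ n ih =>
    refine mem_repr_succ.2 ⟨h0, fun c => mem_repr_of_approx fun N => ?_⟩
    have had : ∀ (k : ℕ) {g : WordFun L}, g ∈ repr F n → logTerm F z k g ∈ repr F n := by
      intro k g hg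
      refine Submodule.smul_mem _ _ ?_
      induction k with
      | zero => exact hg
      | succ k ihk => rw [pow_succ']; exact lie_mem_repr ih ihk
    induction N with
    | zero => exact ⟨0, zero_mem _, mem_vanishing_zero _⟩
    | succ N ihN =>
      obtain ⟨g, hg, hgN⟩ := ihN
      -- One more iteration of the equation for ∂_c z, solved for its term k = 0; it gains an order.
      refine ⟨const c - ∑ k ∈ range N, logTerm F z (k + 1) g,
        sub_mem (const_mem_repr c n) (sum_mem fun k _ => had _ hg), ?_⟩
      have h1 := hzc c N
      rw [sum_range_succ', logTerm_zero] at h1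
      have h2 : ∑ k ∈ range N, logTerm F z (k + 1) (deriv F c z - g) ∈ vanishing F (N + 1) :=
        sum_mem fun k _ => vanishing_mono (by omega) (logTerm_mem_vanishing hz hgN (k + 1))
      simp only [map_sub, sum_sub_distrib] at h2
      convert sub_mem h1 h2 using 1
      abel

end Log

-- The embedding into the universal enveloping algebra

attribute [local instance] LieRing.ofAssociativeRing

variable (F L) in
/-- The functions on which the derivatives `deriv F c` form a representation of `L`. -/
def reprSubmodule : Submodule F (WordFun L) := ⨅ n, repr F n

theorem mem_reprSubmodule {f : WordFun L} : f ∈ reprSubmodule L F ↔ ∀ n, f ∈ repr F n := by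
  simp [reprSubmodule]

theorem deriv_mem_reprSubmodule (c : L) {f : WordFun L} (hf : f ∈ reprSubmodule L F) :
    deriv F c f ∈ reprSubmodule L F := by
  rw [mem_reprSubmodule] at *
  exact fun n => (mem_repr_succ.1 (hf (n + 1))).2 c

variable (F L) in
/-- The representation of `L` by derivatives. -/
def derivRep : L →ₗ⁅F⁆ Module.End F (reprSubmodule L F) where
  toFun c := (deriv F c).restrict fun _ hf => deriv_mem_reprSubmodule c hf
  map_add' a b := by
    ext ⟨f, hf⟩ : 2
    exact (mem_repr_zero.1 (mem_reprSubmodule.1 hf 0)).1 a b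
  map_smul' r a := by
    ext ⟨f, hf⟩ : 2
    exact (mem_repr_zero.1 (mem_reprSubmodule.1 hf 0)).2.1 r a
  map_lie' {a b} := by
    ext ⟨f, hf⟩ : 2
    exact (mem_repr_zero.1 (mem_reprSubmodule.1 hf 0)).2.2 a b

/-- The derivative of the logarithm in direction `c`, evaluated at the empty word, is `c`. -/
theorem derivRep_injective [CharZero F] : Function.Injective (derivRep L F) := by
  obtain ⟨z, hz, hzc⟩ := exists_log (L := L) F
  have hzm : z ∈ reprSubmodule L F := mem_reprSubmodule.2 (log_mem_repr hz hzc)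
  have h : ∀ c, z [c] = c := by
    intro c
    have := hzc c 0 [] Nat.one_pos
    rw [sum_range_one, logTerm_zero] at this
    exact sub_eq_zero.1 this
  intro a b hab
  have : (derivRep L F a ⟨z, hzm⟩ : WordFun L) [] = (derivRep L F b ⟨z, hzm⟩ : WordFun L) [] := by
    rw [hab]
  rw [← h a, ← h b]
  exact this

end WordFun

/-- A Lie algebra over a field of characteristic zero embeds into its universal enveloping
algebra. -/
theorem UniversalEnvelopingAlgebra.ι_injective {F L : Type*} [Field F] [CharZero F] [LieRing L]
    [LieAlgebra F L] : Function.Injective (UniversalEnvelopingAlgebra.ι F : L → _) := by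
  intro a b hab
  refine WordFun.derivRep_injective (F := F) ?_
  rw [← UniversalEnvelopingAlgebra.lift_ι_apply F (WordFun.derivRep L F) a, hab,
    UniversalEnvelopingAlgebra.lift_ι_apply]

/-! ### Conjugation and differentiation of divided powers -/

section DividedPowers

variable {F : Type*} [Field F] [CharZero F] {B : Type*} [Ring B] [Algebra F B]

theorem succ_smul_divPow (x : B) (n : ℕ) :
    ((n : F) + 1) • (((n + 1).factorial : F)⁻¹ • x ^ (n + 1)) =
      ((n.factorial : F)⁻¹ • x ^ n) * x := by
  have h1 : ((n : F) + 1) ≠ 0 := by exact_mod_cast Nat.succ_ne_zero n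
  rw [smul_smul, smul_mul_assoc, ← pow_succ, Nat.factorial_succ]
  push_cast
  rw [mul_inv, mul_inv_cancel_left₀ h1]

/-- `v xⁿ / n!` as a sum over the terms of `e ^ x * e ^ (-ad x) v`. -/
theorem mul_divPow_eq_sum {x v : B} {u : ℕ → B} (h0 : u 0 = v)
    (hu : ∀ k : ℕ, ((k : F) + 1) • u (k + 1) = -(x * u k - u k * x)) (n : ℕ) :
    v * ((n.factorial : F)⁻¹ • x ^ n) =
      ∑ p ∈ antidiagonal n, ((p.1.factorial : F)⁻¹ • x ^ p.1) * u p.2 := by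
  induction n with
  | zero => simp [h0]
  | succ n ih =>
    have h1 : ((n : F) + 1) ≠ 0 := by exact_mod_cast Nat.succ_ne_zero n
    refine smul_right_injective B h1 ?_
    change ((n : F) + 1) • _ = ((n : F) + 1) • _
    rw [← mul_smul_comm, succ_smul_divPow, ← mul_assoc, ih, sum_mul]
    -- On the antidiagonal the weight is p.1 + p.2: the first part lowers a divided power, the
    -- second applies the recurrence of `u`.
    have h2 : ((n : F) + 1) • ∑ p ∈ antidiagonal (n + 1),
          ((p.1.factorial : F)⁻¹ • x ^ p.1) * u p.2 =
        ∑ p ∈ antidiagonal (n + 1), ((p.1 : F) • ((p.1.factorial : F)⁻¹ • x ^ p.1)) * u p.2 +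
        ∑ p ∈ antidiagonal (n + 1), ((p.1.factorial : F)⁻¹ • x ^ p.1) * ((p.2 : F) • u p.2) := by
      rw [smul_sum, ← sum_add_distrib]
      refine sum_congr rfl fun p hp => ?_
      rw [HasAntidiagonal.mem_antidiagonal] at hp
      rw [smul_mul_assoc (p.1 : F), mul_smul_comm (p.2 : F), ← add_smul]
      congr 1
      exact_mod_cast hp.symm
    rw [h2, Finset.Nat.sum_antidiagonal_succ, Finset.Nat.sum_antidiagonal_succ']
    simp only [Nat.cast_succ, succ_smul_divPow, hu, Nat.cast_zero, zero_smul, zero_mul, mul_zero,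
      zero_add, ← sum_add_distrib]
    refine sum_congr rfl fun p _ => ?_
    noncomm_ring

/-- The derivative of `x ^ (n + 1) / (n + 1)!` as a sum over the terms of
`e ^ x * ((1 - e ^ (-ad x)) / ad x) (D x)`. -/
theorem derivation_divPow_eq_sum (D : B →ₗ[F] B) (hD : ∀ a b, D (a * b) = D a * b + a * D b)
    {x : B} {u : ℕ → B} (h0 : u 0 = D x)
    (hu : ∀ k : ℕ, ((k : F) + 2) • u (k + 1) = -(x * u k - u k * x)) (n : ℕ) :
    D (((n + 1).factorial : F)⁻¹ • x ^ (n + 1)) =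
      ∑ p ∈ antidiagonal n, ((p.1.factorial : F)⁻¹ • x ^ p.1) * u p.2 := by
  induction n with
  | zero => simp [h0]
  | succ n ih =>
    have h1 : ((n : F) + 2) ≠ 0 := by exact_mod_cast Nat.succ_ne_zero (n + 1)
    refine smul_right_injective B h1 ?_
    change ((n : F) + 2) • _ = ((n : F) + 2) • _
    have h3 := succ_smul_divPow (F := F) x (n + 1)
    rw [show (((n + 1 : ℕ) : F) + 1) = n + 2 by push_cast; ring] at h3
    rw [← map_smul, h3, hD, ih, sum_mul, ← h0]
    -- Here the weight splits as p.1 + (p.2 + 1), to match the recurrence of `u`.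
    have h2 : ((n : F) + 2) • ∑ p ∈ antidiagonal (n + 1),
          ((p.1.factorial : F)⁻¹ • x ^ p.1) * u p.2 =
        ∑ p ∈ antidiagonal (n + 1), ((p.1 : F) • ((p.1.factorial : F)⁻¹ • x ^ p.1)) * u p.2 +
        ∑ p ∈ antidiagonal (n + 1),
          ((p.1.factorial : F)⁻¹ • x ^ p.1) * (((p.2 : F) + 1) • u p.2) := by
      rw [smul_sum, ← sum_add_distrib]
      refine sum_congr rfl fun p hp => ?_
      rw [HasAntidiagonal.mem_antidiagonal] at hp
      rw [smul_mul_assoc (p.1 : F), mul_smul_comm ((p.2 : F) + 1), ← add_smul]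
      congr 1
      have : (p.1 : F) + p.2 = n + 1 := by exact_mod_cast hp
      linear_combination -this
    have h4 : ∀ k : ℕ, (((k + 1 : ℕ) : F) + 1) = (k : F) + 2 := fun k => by push_cast; ring
    rw [h2, Finset.Nat.sum_antidiagonal_succ, Finset.Nat.sum_antidiagonal_succ']
    simp only [h4, hu]
    simp only [Nat.cast_succ, succ_smul_divPow, Nat.cast_zero, zero_smul, zero_mul, zero_add,
      one_smul]
    rw [← add_assoc, add_right_comm, ← sum_add_distrib]
    congr 1
    refine sum_congr rfl fun p _ => ?_
    noncomm_ring

end DividedPowers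

/-! ### Series in `ad` and logarithmic derivatives over a Lie algebra -/

namespace BiSeries

section Lie

variable {L : Type*} [LieRing L]

theorem degree_add (d e : Fin 2 →₀ ℕ) : (d + e).degree = d.degree + e.degree := map_add _ d e

theorem degree_eq_of_mem_antidiagonal {d : Fin 2 →₀ ℕ} {p : (Fin 2 →₀ ℕ) × (Fin 2 →₀ ℕ)}
    (hp : p ∈ antidiagonal d) : p.1.degree + p.2.degree = d.degree := by
  rw [← HasAntidiagonal.mem_antidiagonal.1 hp, degree_add]

theorem bracket_eq_zero_of_degree_lt {a b : BiSeries L} {m n : ℕ}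
    (ha : ∀ d, d.degree < m → a d = 0) (hb : ∀ d, d.degree < n → b d = 0)
    (d : Fin 2 →₀ ℕ) (hd : d.degree < m + n) : bracket a b d = 0 := by
  refine sum_eq_zero fun p hp => ?_
  have := degree_eq_of_mem_antidiagonal hp
  rcases lt_or_ge p.1.degree m with h | h
  · rw [ha _ h, zero_lie]
  · rw [hb _ (by omega), lie_zero]

/-- Without constant terms, both factors of every nonzero term have degree strictly below that of
the product. -/
theorem bracket_congr {a a' b b' : BiSeries L} {n : ℕ} (ha0 : a 0 = 0) (ha0' : a' 0 = 0)
    (hb0 : b 0 = 0) (hb0' : b' 0 = 0) (ha : ∀ d, d.degree < n → a d = a' d)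
    (hb : ∀ d, d.degree < n → b d = b' d) (d : Fin 2 →₀ ℕ) (hd : d.degree ≤ n) :
    bracket a b d = bracket a' b' d := by
  refine sum_congr rfl fun p hp => ?_
  have := degree_eq_of_mem_antidiagonal hp
  by_cases h1 : p.1 = 0
  · rw [h1, ha0, ha0', zero_lie, zero_lie]
  by_cases h2 : p.2 = 0
  · rw [h2, hb0, hb0', lie_zero, lie_zero]
  rw [← Finsupp.degree_eq_zero_iff] at h1 h2
  rw [ha _ (by omega), hb _ (by omega)]

theorem bracket_apply_zero (a b : BiSeries L) : bracket a b 0 = ⁅a 0, b 0⁆ := by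
  simp [bracket]

theorem iterate_bracket_eq_zero_of_degree_lt {a : BiSeries L} (ha : a 0 = 0) (b : BiSeries L)
    (k : ℕ) (d : Fin 2 →₀ ℕ) (hd : d.degree < k) : ((bracket a)^[k] b) d = 0 := by
  induction k generalizing d with
  | zero => omega
  | succ k ih =>
    rw [Function.iterate_succ_apply']
    refine bracket_eq_zero_of_degree_lt (m := 1) (fun e he => ?_) ih d (by omega)
    rw [(Finsupp.degree_eq_zero_iff e).1 (by omega), ha]

variable {F : Type*} [Field F] [LieAlgebra F L]

/-- The series `∑ₖ c k xᵏ` in `ad a`, applied to `b`. -/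
noncomputable def adSeries (c : ℕ → F) (a b : BiSeries L) : BiSeries L :=
  fun d => ∑ k ∈ range (d.degree + 1), c k • ((bracket a)^[k] b) d

theorem adSeries_eq_sum (c : ℕ → F) {a : BiSeries L} (ha : a 0 = 0) (b : BiSeries L)
    (d : Fin 2 →₀ ℕ) {N : ℕ} (hN : d.degree < N) :
    adSeries c a b d = ∑ k ∈ range N, c k • ((bracket a)^[k] b) d := by
  refine sum_subset (range_mono hN) fun k _ hk => ?_
  rw [mem_range, not_lt] at hk
  rw [iterate_bracket_eq_zero_of_degree_lt ha b k d hk, smul_zero]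

theorem adSeries_apply_zero (c : ℕ → F) (a b : BiSeries L) : adSeries c a b 0 = c 0 • b 0 := by
  simp [adSeries]

/-- Beyond k = 0 every term has at least one bracket, so `bracket_congr` gains a degree; the
subtraction removes k = 0. -/
theorem adSeries_sub_congr (c : ℕ → F) {a a' b b' : BiSeries L} {n : ℕ} (ha0 : a 0 = 0)
    (ha0' : a' 0 = 0) (hb0 : b 0 = 0) (hb0' : b' 0 = 0) (ha : ∀ d, d.degree < n → a d = a' d)
    (hb : ∀ d, d.degree < n → b d = b' d) (d : Fin 2 →₀ ℕ) (hd : d.degree ≤ n) :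
    adSeries c a b d - c 0 • b d = adSeries c a' b' d - c 0 • b' d := by
  have h0 : ∀ {a b : BiSeries L}, a 0 = 0 → b 0 = 0 → ∀ k, ((bracket a)^[k] b) 0 = 0 := by
    intro a b ha hb k
    cases k with
    | zero => exact hb
    | succ k => rw [Function.iterate_succ_apply', bracket_apply_zero, ha, zero_lie]
  have h : ∀ k, ∀ d, d.degree ≤ n →
      ((bracket a)^[k + 1] b) d = ((bracket a')^[k + 1] b') d := by
    intro k
    induction k with
    | zero => exact bracket_congr ha0 ha0' hb0 hb0' ha hb
    | succ k ih =>
      intro d hd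
      rw [Function.iterate_succ_apply', Function.iterate_succ_apply' _ (k + 1)]
      exact bracket_congr ha0 ha0' (h0 ha0 hb0 _) (h0 ha0' hb0' _) ha
        (fun d hd => ih d hd.le) d hd
  rw [adSeries, adSeries, sum_range_succ', sum_range_succ']
  simp only [Function.iterate_zero, id, add_sub_cancel_right]
  exact sum_congr rfl fun k _ => by rw [h k d hd]

theorem adSeries_congr (c : ℕ → F) {a a' b b' : BiSeries L} {n : ℕ} (ha0 : a 0 = 0)
    (ha0' : a' 0 = 0) (hb0 : b 0 = 0) (hb0' : b' 0 = 0) (ha : ∀ d, d.degree < n → a d = a' d)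
    (hb : ∀ d, d.degree < n → b d = b' d) (d : Fin 2 →₀ ℕ) (hd : d.degree < n) :
    adSeries c a b d = adSeries c a' b' d := by
  have := adSeries_sub_congr c ha0 ha0' hb0 hb0' ha hb d hd.le
  rwa [hb d hd, sub_left_inj] at this

variable (F) in
/-- The Euler derivation, which multiplies each term by its total degree. -/
noncomputable def euler {V : Type*} [AddCommGroup V] [Module F V] : BiSeries V →ₗ[F] BiSeries V where
  toFun f := fun d => (d.degree : F) • f d
  map_add' _ _ := funext fun _ => smul_add _ _ _
  map_smul' r _ := funext fun d => smul_comm (d.degree : F) r _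

theorem euler_apply {V : Type*} [AddCommGroup V] [Module F V] (f : BiSeries V)
    (d : Fin 2 →₀ ℕ) : euler F f d = (d.degree : F) • f d := rfl

theorem euler_apply_zero {V : Type*} [AddCommGroup V] [Module F V] (f : BiSeries V) :
    euler F f 0 = 0 := by simp [euler_apply]

variable (F) in
/-- The logarithmic derivative of `e ^ a`. -/
noncomputable def logDeriv (a : BiSeries L) : BiSeries L := adSeries (logCoeff F) a (euler F a)

variable (F) in
/-- The logarithmic derivative of `e ^ a * e ^ b`. -/
noncomputable def logDerivMul (a b : BiSeries L) : BiSeries L :=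
  adSeries (expNegCoeff F) b (logDeriv F a) + logDeriv F b

theorem logDeriv_apply_zero (a : BiSeries L) : logDeriv F a 0 = 0 := by
  rw [logDeriv, adSeries_apply_zero, euler_apply_zero, smul_zero]

theorem logDerivMul_apply_zero (a b : BiSeries L) : logDerivMul F a b 0 = 0 := by
  change adSeries _ _ _ 0 + logDeriv F b 0 = 0
  rw [adSeries_apply_zero, logDeriv_apply_zero, logDeriv_apply_zero, smul_zero, add_zero]

/-- The recursion step for factorizations: apart from its linear part, a coefficient of the
logarithmic derivative depends only on coefficients of strictly lower degree. -/
theorem logDerivMul_sub_congr {a a' b b' : BiSeries L} {n : ℕ} (ha0 : a 0 = 0)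
    (ha0' : a' 0 = 0) (hb0 : b 0 = 0) (hb0' : b' 0 = 0) (ha : ∀ d, d.degree < n → a d = a' d)
    (hb : ∀ d, d.degree < n → b d = b' d) (d : Fin 2 →₀ ℕ) (hd : d.degree ≤ n) :
    logDerivMul F a b d - (d.degree : F) • (a d + b d) =
      logDerivMul F a' b' d - (d.degree : F) • (a' d + b' d) := by
  have he : ∀ {a a' : BiSeries L}, (∀ d, d.degree < n → a d = a' d) →
      ∀ d, d.degree < n → euler F a d = euler F a' d := by
    intro a a' h d hd
    rw [euler_apply, euler_apply, h d hd]
  have h1 := adSeries_sub_congr (logCoeff F) ha0 ha0' (euler_apply_zero a) (euler_apply_zero a')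
    ha (he ha) d hd
  have h2 := adSeries_sub_congr (logCoeff F) hb0 hb0' (euler_apply_zero b) (euler_apply_zero b')
    hb (he hb) d hd
  have h3 := adSeries_sub_congr (expNegCoeff F) hb0 hb0' (logDeriv_apply_zero a)
    (logDeriv_apply_zero a') hb (adSeries_congr (logCoeff F) ha0 ha0' (euler_apply_zero a)
      (euler_apply_zero a') ha (he ha)) d hd
  rw [logCoeff_zero, one_smul, one_smul, euler_apply, euler_apply] at h1 h2
  rw [expNegCoeff_zero, one_smul, one_smul] at h3
  change adSeries _ b (logDeriv F a) d + logDeriv F b d - _ =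
    adSeries _ b' (logDeriv F a') d + logDeriv F b' d - _
  change logDeriv F a d - _ = logDeriv F a' d - _ at h1
  change logDeriv F b d - _ = logDeriv F b' d - _ at h2
  rw [smul_add, smul_add]
  linear_combination (norm := module) h1 + h2 + h3

section Map

variable {M : Type*} [LieRing M] [LieAlgebra F M] (φ : L →ₗ⁅F⁆ M)

theorem mapCoeff_bracket (a b : BiSeries L) :
    mapCoeff φ (bracket a b) = bracket (mapCoeff φ a) (mapCoeff φ b) := by
  funext d
  change φ (∑ p ∈ _, _) = ∑ p ∈ _, _
  rw [map_sum]
  exact sum_congr rfl fun p _ => LieHom.map_lie φ _ _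

theorem mapCoeff_adSeries (c : ℕ → F) (a b : BiSeries L) :
    mapCoeff φ (adSeries c a b) = adSeries c (mapCoeff φ a) (mapCoeff φ b) := by
  have h : ∀ k, mapCoeff φ ((bracket a)^[k] b) = (bracket (mapCoeff φ a))^[k] (mapCoeff φ b) := by
    intro k
    induction k with
    | zero => rfl
    | succ k ih =>
      rw [Function.iterate_succ_apply', Function.iterate_succ_apply', mapCoeff_bracket, ih]
  funext d
  change φ (∑ k ∈ _, _) = ∑ k ∈ _, _
  rw [map_sum]
  refine sum_congr rfl fun k _ => ?_
  rw [map_smul, ← h k]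
  rfl

theorem mapCoeff_euler (a : BiSeries L) : mapCoeff φ (euler F a) = euler F (mapCoeff φ a) :=
  funext fun d => map_smul φ (d.degree : F) (a d)

/-- Only brackets and the Euler derivation enter, so computations in the enveloping algebra come
back to the Lie algebra. -/
theorem mapCoeff_logDerivMul (a b : BiSeries L) :
    mapCoeff φ (logDerivMul F a b) = logDerivMul F (mapCoeff φ a) (mapCoeff φ b) := by
  have hadd : ∀ f g : BiSeries L, mapCoeff φ (f + g) = mapCoeff φ f + mapCoeff φ g :=
    fun f g => funext fun d => map_add φ _ _
  simp only [logDerivMul, logDeriv, hadd, mapCoeff_adSeries, mapCoeff_euler]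

end Map

end Lie

/-! ### Exponentials over an associative algebra -/

section Assoc

attribute [local instance] LieRing.ofAssociativeRing

variable {F : Type*} [Field F] {A : Type*} [Ring A] [Algebra F A]

theorem mul_apply (f g : BiSeries A) (d : Fin 2 →₀ ℕ) :
    (f * g) d = ∑ p ∈ antidiagonal d, f p.1 * g p.2 := MvPowerSeries.coeff_mul d f g

theorem bracket_eq_commutator (f g : BiSeries A) : bracket f g = f * g - g * f := by
  funext d
  change _ = (f * g) d - (g * f) d
  have h : ∑ p ∈ antidiagonal d, g p.1 * f p.2 = ∑ p ∈ antidiagonal d, g p.2 * f p.1 :=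
    sum_equiv (Equiv.prodComm _ _) (fun p => by simp [add_comm]) fun p _ => rfl
  rw [mul_apply, mul_apply, h, ← sum_sub_distrib]
  rfl

theorem mul_eq_zero_of_degree_lt {a b : BiSeries A} {m n : ℕ}
    (ha : ∀ d, d.degree < m → a d = 0) (hb : ∀ d, d.degree < n → b d = 0)
    (d : Fin 2 →₀ ℕ) (hd : d.degree < m + n) : (a * b) d = 0 := by
  rw [mul_apply]
  refine sum_eq_zero fun p hp => ?_
  have := degree_eq_of_mem_antidiagonal hp
  rcases lt_or_ge p.1.degree m with h | h
  · rw [ha _ h, zero_mul]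
  · rw [hb _ (by omega), mul_zero]

theorem euler_mul (f g : BiSeries A) : euler F (f * g) = euler F f * g + f * euler F g := by
  funext d
  change _ = (euler F f * g) d + (f * euler F g) d
  rw [euler_apply, mul_apply, mul_apply, mul_apply, smul_sum, ← sum_add_distrib]
  refine sum_congr rfl fun p hp => ?_
  rw [euler_apply, euler_apply, smul_mul_assoc, mul_smul_comm, ← add_smul,
    ← degree_eq_of_mem_antidiagonal hp, Nat.cast_add]

theorem pow_eq_zero_of_degree_lt {x : BiSeries A} (hx : x 0 = 0) (n : ℕ) (d : Fin 2 →₀ ℕ)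
    (hd : d.degree < n) : (x ^ n) d = 0 := by
  induction n generalizing d with
  | zero => omega
  | succ n ih =>
    rw [pow_succ]
    refine mul_eq_zero_of_degree_lt ih (n := 1) (fun e he => ?_) d hd
    rw [(Finsupp.degree_eq_zero_iff e).1 (by omega), hx]

theorem smul_apply' (r : F) (f : BiSeries A) (d : Fin 2 →₀ ℕ) : (r • f) d = r • f d := rfl

theorem sum_apply' {ι : Type*} (s : Finset ι) (f : ι → BiSeries A) (d : Fin 2 →₀ ℕ) :
    (∑ i ∈ s, f i) d = ∑ i ∈ s, f i d := Finset.sum_apply d s f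

theorem exp_apply_eq_sum {x : BiSeries A} (hx : x 0 = 0) (d : Fin 2 →₀ ℕ) {N : ℕ}
    (hN : d.degree < N) :
    exp F x d = (∑ n ∈ range N, ((n.factorial : F)⁻¹) • x ^ n) d :=
  coeff_exp F x hx d N hN

theorem exp_apply_zero (x : BiSeries A) : exp F x 0 = 1 := by
  change ∑ n ∈ range 1, _ = _
  simp

theorem exp_mul_exp_apply_zero (x y : BiSeries A) : (exp F x * exp F y) 0 = 1 := by
  rw [mul_apply]
  simp [exp_apply_zero]

/-- A product of two locally finite sums, arranged by degree. -/
theorem exp_mul_adSeries_apply (c : ℕ → F) {x : BiSeries A} (hx : x 0 = 0) (v : BiSeries A)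
    (d : Fin 2 →₀ ℕ) :
    (exp F x * adSeries c x v) d = (∑ n ∈ range (d.degree + 1), ∑ p ∈ antidiagonal n,
      ((p.1.factorial : F)⁻¹ • x ^ p.1) * (c p.2 • (bracket x)^[p.2] v)) d := by
  have h1 : (exp F x * adSeries c x v) d =
      ((∑ i ∈ range (d.degree + 1), (i.factorial : F)⁻¹ • x ^ i) *
        ∑ j ∈ range (d.degree + 1), c j • (bracket x)^[j] v) d := by
    rw [mul_apply, mul_apply]
    refine sum_congr rfl fun p hp => ?_
    have := degree_eq_of_mem_antidiagonal hp
    rw [exp_apply_eq_sum hx p.1 (N := d.degree + 1) (by omega),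
      adSeries_eq_sum c hx v p.2 (N := d.degree + 1) (by omega), sum_apply' _ _ p.2]
    rfl
  rw [h1, sum_mul_sum, sum_apply', sum_apply']
  simp only [sum_apply']
  refine sum_range_sum_range_eq_sum_antidiagonal (fun i j =>
    (((i.factorial : F)⁻¹ • x ^ i) * (c j • (bracket x)^[j] v) : BiSeries A) d) _ fun i j hij => ?_
  refine mul_eq_zero_of_degree_lt (m := i) (n := j) (fun e he => ?_) (fun e he => ?_) d (by omega)
  · rw [smul_apply', pow_eq_zero_of_degree_lt hx i e he, smul_zero]
  · rw [smul_apply', iterate_bracket_eq_zero_of_degree_lt hx v j e he, smul_zero]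

variable [CharZero F]

/-- This is e^(-x) v e^x = e^(-ad x) v, obtained by summing `mul_divPow_eq_sum` over n. -/
theorem mul_exp {x : BiSeries A} (hx : x 0 = 0) (v : BiSeries A) :
    v * exp F x = exp F x * adSeries (expNegCoeff F) x v := by
  funext d
  rw [exp_mul_adSeries_apply _ hx]
  have h1 : (v * exp F x) d =
      (v * ∑ i ∈ range (d.degree + 1), (i.factorial : F)⁻¹ • x ^ i) d := by
    rw [mul_apply, mul_apply]
    refine sum_congr rfl fun p hp => ?_
    have := degree_eq_of_mem_antidiagonal hp
    rw [exp_apply_eq_sum hx p.2 (N := d.degree + 1) (by omega)]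
  rw [h1, mul_sum]
  refine congrFun (sum_congr rfl fun n _ => ?_) d
  refine mul_divPow_eq_sum (u := fun k => expNegCoeff F k • (bracket x)^[k] v) ?_ (fun k => ?_) n
  · simp [expNegCoeff_zero]
  · rw [smul_smul, expNegCoeff_succ, Function.iterate_succ_apply', bracket_eq_commutator,
      neg_smul, smul_sub, mul_smul_comm, smul_mul_assoc]

theorem euler_exp {x : BiSeries A} (hx : x 0 = 0) :
    euler F (exp F x) = exp F x * logDeriv F x := by
  funext d
  -- One extra term of the exponential is kept, because its constant term drops out and shifts the
  -- index.
  rw [logDeriv, exp_mul_adSeries_apply _ hx, euler_apply,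
    exp_apply_eq_sum hx d (N := d.degree + 1 + 1) (by omega), ← euler_apply, map_sum,
    sum_range_succ']
  have h0 : euler F (((Nat.factorial 0 : ℕ) : F)⁻¹ • x ^ 0) = 0 := by
    rw [map_smul, pow_zero]
    have h := euler_mul (F := F) (1 : BiSeries A) 1
    rw [mul_one, one_mul, mul_one, left_eq_add] at h
    rw [h, smul_zero]
  rw [h0, add_zero]
  refine congrFun (sum_congr rfl fun n _ => ?_) d
  refine derivation_divPow_eq_sum (euler F) euler_mul
    (u := fun k => logCoeff F k • (bracket x)^[k] (euler F x)) ?_ (fun k => ?_) n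
  · simp [logCoeff_zero]
  · rw [smul_smul, logCoeff_succ, Function.iterate_succ_apply', bracket_eq_commutator,
      neg_smul, smul_sub, mul_smul_comm, smul_mul_assoc]

theorem euler_exp_mul_exp {x y : BiSeries A} (hx : x 0 = 0) (hy : y 0 = 0) :
    euler F (exp F x * exp F y) = exp F x * exp F y * logDerivMul F x y := by
  rw [euler_mul, euler_exp hx, euler_exp hy, mul_assoc, mul_exp hy, logDerivMul, mul_add, mul_assoc,
    mul_assoc]

theorem mul_apply_eq_add {f g : BiSeries A} {d : Fin 2 →₀ ℕ}
    (hg : ∀ e, e.degree < d.degree → g e = 0) : (f * g) d = f 0 * g d := by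
  rw [mul_apply]
  refine sum_eq_single_of_mem (0, d) (by simp) fun p hp hne => ?_
  have h := degree_eq_of_mem_antidiagonal hp
  rw [hg p.2, mul_zero]
  by_contra hlt
  have h1 : p.1 = 0 := (Finsupp.degree_eq_zero_iff _).1 (by omega)
  refine hne (Prod.ext h1 ?_)
  have := HasAntidiagonal.mem_antidiagonal.1 hp
  rwa [h1, zero_add] at this

/-- Products of exponentials are determined by their logarithmic derivatives. -/
theorem exp_mul_exp_eq_iff {x y a b : BiSeries A} (hx : x 0 = 0) (hy : y 0 = 0) (ha : a 0 = 0)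
    (hb : b 0 = 0) : exp F x * exp F y = exp F a * exp F b ↔
      logDerivMul F x y = logDerivMul F a b := by
  have key : ∀ f : BiSeries A, (∀ n, (∀ e, e.degree < n → f e = 0) → ∀ e, e.degree = n → f e = 0) →
      f = 0 := by
    intro f h
    have : ∀ n, ∀ e, e.degree < n → f e = 0 := by
      intro n
      induction n with
      | zero => intro e he; omega
      | succ n ih =>
        intro e he
        rcases Nat.lt_succ_iff_lt_or_eq.1 he with h' | h'
        · exact ih e h'
        · exact h n ih e h'
    exact funext fun e => this _ e (Nat.lt_succ_self _)
  constructor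
  · intro h
    have h1 := euler_exp_mul_exp (F := F) hx hy
    rw [h, euler_exp_mul_exp ha hb, ← sub_eq_zero, ← mul_sub] at h1
    rw [eq_comm, ← sub_eq_zero]
    refine key _ fun n hn e he => ?_
    have h2 := congrFun h1 e
    -- In the lowest degree only the constant term 1 of the product of exponentials contributes.
    rw [mul_apply_eq_add (by rwa [he]), exp_mul_exp_apply_zero, one_mul] at h2
    exact h2
  · intro h
    have h1 : euler F (exp F x * exp F y - exp F a * exp F b) =
        (exp F x * exp F y - exp F a * exp F b) * logDerivMul F a b := by
      rw [map_sub, euler_exp_mul_exp hx hy, euler_exp_mul_exp ha hb, h, sub_mul]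
    rw [← sub_eq_zero]
    refine key _ fun n hn e he => ?_
    rcases Nat.eq_zero_or_pos n with rfl | hpos
    · rw [(Finsupp.degree_eq_zero_iff e).1 he]
      change (exp F x * exp F y) 0 - (exp F a * exp F b) 0 = 0
      rw [exp_mul_exp_apply_zero, exp_mul_exp_apply_zero, sub_self]
    · have h2 := congrFun h1 e
      -- The difference f satisfies E f = f · ω with ω free of constant term, so deg e · f_e
      -- involves only lower coefficients of f, which are zero.
      rw [mul_eq_zero_of_degree_lt hn (n := 1) (fun e he => by
        rw [(Finsupp.degree_eq_zero_iff e).1 (by omega), logDerivMul_apply_zero]) e (by omega),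
        euler_apply] at h2
      refine (smul_eq_zero.1 h2).resolve_left ?_
      rw [he]
      exact_mod_cast hpos.ne'

end Assoc

end BiSeries

/-! ### Factorization along a decomposition of the Lie algebra -/

namespace BiSeries

variable {F : Type*} [Field F] {𝔤 : Type*} [LieRing 𝔤] [LieAlgebra F 𝔤]

section

attribute [local instance] LieRing.ofAssociativeRing

theorem mapCoeff_ι_apply_zero {x : BiSeries 𝔤} (hx : x 0 = 0) :
    mapCoeff (UniversalEnvelopingAlgebra.ι F) x 0 = 0 := by
  change UniversalEnvelopingAlgebra.ι F (x 0) = 0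
  rw [hx, map_zero]

/-- Injectivity of ι enters here, to descend the equality of logarithmic derivatives from U(𝔤) to 𝔤.
-/
theorem lieExp_mul_lieExp_eq_iff [CharZero F] {x y a b : BiSeries 𝔤} (hx : x 0 = 0) (hy : y 0 = 0)
    (ha : a 0 = 0) (hb : b 0 = 0) : lieExp F x * lieExp F y = lieExp F a * lieExp F b ↔
      logDerivMul F x y = logDerivMul F a b := by
  rw [lieExp, lieExp, lieExp, lieExp, exp_mul_exp_eq_iff (mapCoeff_ι_apply_zero hx)
    (mapCoeff_ι_apply_zero hy) (mapCoeff_ι_apply_zero ha) (mapCoeff_ι_apply_zero hb),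
    ← mapCoeff_logDerivMul, ← mapCoeff_logDerivMul]
  exact ⟨fun h => funext fun d => UniversalEnvelopingAlgebra.ι_injective (congrFun h d),
    fun h => by rw [h]⟩

end

/-- Uniqueness of the factorization along a decomposition `𝔤 = P ⊕ Q`. -/
theorem lieExp_factorization_unique [CharZero F] {P Q : Submodule F 𝔤} (hPQ : Disjoint P Q)
    {a b a' b' : BiSeries 𝔤} (ha : a ∈ inside P) (hb : b ∈ inside Q) (ha' : a' ∈ inside P)
    (hb' : b' ∈ inside Q) (ha0 : a 0 = 0) (hb0 : b 0 = 0) (ha0' : a' 0 = 0) (hb0' : b' 0 = 0)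
    (h : lieExp F a * lieExp F b = lieExp F a' * lieExp F b') : a = a' ∧ b = b' := by
  rw [lieExp_mul_lieExp_eq_iff ha0 hb0 ha0' hb0'] at h
  have key : ∀ n d, d.degree < n → a d = a' d ∧ b d = b' d := by
    intro n
    induction n with
    | zero => intro d hd; omega
    | succ n ih =>
      intro d hd
      by_cases hd0 : d = 0
      · rw [hd0, ha0, ha0', hb0, hb0']
        exact ⟨rfl, rfl⟩
      have h1 := logDerivMul_sub_congr (F := F) ha0 ha0' hb0 hb0' (fun d hd => (ih d hd).1)
        (fun d hd => (ih d hd).2) d (by omega)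
      rw [h, sub_right_inj] at h1
      have h2 : (d.degree : F) ≠ 0 := by
        rwa [Nat.cast_ne_zero, Ne, Finsupp.degree_eq_zero_iff]
      have h3 : a d - a' d = b' d - b d := by
        rw [sub_eq_sub_iff_add_eq_add, smul_right_injective _ h2 h1, add_comm]
      -- The sums a_d + b_d and a'_d + b'_d agree, so the difference lies in both subspaces.
      have h4 : a d - a' d = 0 := Submodule.disjoint_def.1 hPQ _ (P.sub_mem (ha d) (ha' d))
        (by rw [h3]; exact Q.sub_mem (hb' d) (hb d))
      rw [h4, eq_comm, sub_eq_zero] at h3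
      exact ⟨sub_eq_zero.1 h4, h3.symm⟩
  exact ⟨funext fun d => (key _ d (Nat.lt_succ_self _)).1,
    funext fun d => (key _ d (Nat.lt_succ_self _)).2⟩

/-- Existence of the factorization along a decomposition `𝔤 = P ⊕ Q`. -/
theorem exists_lieExp_factorization [CharZero F] {P Q : Submodule F 𝔤} (hPQ : IsCompl P Q)
    {x y : BiSeries 𝔤} (hx : x 0 = 0) (hy : y 0 = 0) : ∃ a ∈ inside P, ∃ b ∈ inside Q, a 0 = 0 ∧ b 0 = 0 ∧
      lieExp F x * lieExp F y = lieExp F a * lieExp F b := by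
  let π : BiSeries 𝔤 → BiSeries 𝔤 := mapCoeff (P.projection Q hPQ)
  let π' : BiSeries 𝔤 → BiSeries 𝔤 := mapCoeff (Q.projection P hPQ.symm)
  have hππ' : ∀ u d, π u d + π' u d = u d :=
    fun u d => Submodule.projection_add_projection_eq_self hPQ (u d)
  have hπ0 : ∀ u : BiSeries 𝔤, u 0 = 0 → π u 0 = 0 := fun u hu => by
    change P.projection Q hPQ (u 0) = 0
    rw [hu, map_zero]
  have hπ0' : ∀ u : BiSeries 𝔤, u 0 = 0 → π' u 0 = 0 := fun u hu => by
    change Q.projection P hPQ.symm (u 0) = 0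
    rw [hu, map_zero]
  have hzero : ∀ u : BiSeries 𝔤, (∀ d : Fin 2 →₀ ℕ, d.degree = 0 → u d = 0) ↔ u 0 = 0 := fun u =>
    ⟨fun h => h 0 (map_zero _), fun h d hd => by rw [(Finsupp.degree_eq_zero_iff d).1 hd, h]⟩
  -- The unknown is u = a + b, with a and b its projections. The equation for the logarithmic
  -- derivative is solved for its linear part deg d · u_d; in degree zero, the convention that the
  -- inverse of 0 is 0 gives u_0 = 0.
  obtain ⟨u, hu0, hu⟩ := exists_fixedPoint_of_contracting (fun d : Fin 2 →₀ ℕ => d.degree)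
    (fun u : BiSeries 𝔤 => fun d => (d.degree : F)⁻¹ • (logDerivMul F x y d -
      (logDerivMul F (π u) (π' u) d - (d.degree : F) • u d)))
    (fun u _ d hd => by
      rw [hd, Nat.cast_zero, inv_zero, zero_smul])
    (fun n (f g : BiSeries 𝔤) hf hg hfg d hd => by
      have hf0 := (hzero f).1 hf
      have hg0 := (hzero g).1 hg
      have := logDerivMul_sub_congr (F := F) (a := π f) (a' := π g) (b := π' f) (b' := π' g)
        (hπ0 f hf0) (hπ0 g hg0) (hπ0' f hf0) (hπ0' g hg0)
        (n := n) (fun d hd => congrArg (P.projection Q hPQ) (hfg d hd))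
        (fun d hd => congrArg (Q.projection P hPQ.symm) (hfg d hd)) d (by omega)
      rw [hππ' f, hππ' g] at this
      change _ • (_ - (_ - _)) = (_ • (_ - (_ - _)) : 𝔤)
      rw [this])
  have hu0 := (hzero u).1 hu0
  refine ⟨π u, fun d => Submodule.projection_apply_mem hPQ (u d), π' u,
    fun d => Submodule.projection_apply_mem hPQ.symm (u d), hπ0 u hu0, hπ0' u hu0,
    (lieExp_mul_lieExp_eq_iff hx hy (hπ0 u hu0) (hπ0' u hu0)).2 (funext fun d => ?_)⟩
  by_cases hd : d = 0
  · rw [hd, logDerivMul_apply_zero, logDerivMul_apply_zero]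
  have h2 : (d.degree : F) ≠ 0 := by rwa [Nat.cast_ne_zero, Ne, Finsupp.degree_eq_zero_iff]
  have h1 := congrFun hu d
  rw [inv_smul_eq_iff₀ h2, ← sub_add, add_eq_right, sub_eq_zero] at h1
  exact h1

theorem add_apply' {V : Type*} [AddCommMonoid V] (f g : BiSeries V) (d : Fin 2 →₀ ℕ) :
    (f + g) d = f d + g d := rfl

/-! ### Setting a variable to zero, and divisibility by a variable -/

section Restrict

variable {A : Type*} [Ring A] [Algebra F A]

/-- The series with the variable `i` set to zero. -/
noncomputable def restrict {V : Type*} [Zero V] (i : Fin 2) (f : BiSeries V) : BiSeries V :=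
  fun d => if d i = 0 then f d else 0

theorem restrict_mul (i : Fin 2) (f g : BiSeries A) :
    restrict i (f * g) = restrict i f * restrict i g := by
  funext d
  rw [mul_apply]
  by_cases h : d i = 0
  · rw [restrict, if_pos h, mul_apply]
    refine sum_congr rfl fun p hp => ?_
    rw [← HasAntidiagonal.mem_antidiagonal.1 hp, Finsupp.add_apply, Nat.add_eq_zero_iff] at h
    rw [restrict, if_pos h.1, restrict, if_pos h.2]
  · rw [restrict, if_neg h, eq_comm]
    refine sum_eq_zero fun p hp => ?_
    rw [← HasAntidiagonal.mem_antidiagonal.1 hp, Finsupp.add_apply, Nat.add_eq_zero_iff,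
      not_and_or] at h
    rcases h with h | h
    · rw [restrict, if_neg h, zero_mul]
    · rw [restrict, restrict, if_neg h, mul_zero]

theorem restrict_one (i : Fin 2) : restrict i (1 : BiSeries A) = 1 := by
  funext d
  by_cases h : d i = 0
  · rw [restrict, if_pos h]
  · rw [restrict, if_neg h]
    have hd : d ≠ 0 := fun hd => h (by rw [hd, Finsupp.zero_apply])
    exact ((MvPowerSeries.coeff_one d).trans (if_neg hd)).symm

theorem restrict_pow (i : Fin 2) (f : BiSeries A) (n : ℕ) :
    restrict i (f ^ n) = restrict i f ^ n := by
  induction n with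
  | zero => rw [pow_zero, pow_zero, restrict_one]
  | succ n ih => rw [pow_succ, pow_succ, restrict_mul, ih]

/-- Setting a variable to zero is multiplicative and preserves 1, hence it commutes with powers. -/
theorem restrict_exp (i : Fin 2) (x : BiSeries A) :
    restrict i (exp F x) = exp F (restrict i x) := by
  funext d
  change _ = ∑ n ∈ _, (n.factorial : F)⁻¹ • (restrict i x ^ n) d
  simp only [← restrict_pow]
  by_cases h : d i = 0
  · simp only [restrict, if_pos h]
    rfl
  · simp only [restrict, if_neg h, smul_zero, sum_const_zero]

theorem restrict_lieExp (i : Fin 2) (x : BiSeries 𝔤) :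
    restrict i (lieExp F x) = lieExp F (restrict i x) := by
  rw [lieExp, restrict_exp, lieExp]
  congr 1
  funext d
  change (if d i = 0 then UniversalEnvelopingAlgebra.ι F (x d) else 0) =
    UniversalEnvelopingAlgebra.ι F (if d i = 0 then x d else 0)
  split_ifs
  · rfl
  · rw [map_zero]

theorem restrict_mem_inside {P : Submodule F 𝔤} (i : Fin 2) {x : BiSeries 𝔤} (hx : x ∈ inside P) :
    restrict i x ∈ inside P := fun d => by
  change (if d i = 0 then x d else 0) ∈ P
  split_ifs
  · exact hx d
  · exact P.zero_mem

end Restrict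

theorem lieExp_zero : lieExp F (0 : BiSeries 𝔤) = 1 := by
  have h : mapCoeff (UniversalEnvelopingAlgebra.ι F) (0 : BiSeries 𝔤) = 0 :=
    funext fun d => map_zero (UniversalEnvelopingAlgebra.ι F)
  rw [lieExp, h]
  funext d
  change ∑ n ∈ range (d.degree + 1), (n.factorial : F)⁻¹ • MvPowerSeries.coeff d (0 ^ n) = _
  rw [sum_eq_single_of_mem 0 (by simp) fun n _ hn => by rw [zero_pow hn, map_zero, smul_zero]]
  simp
  rfl

section MulVar

variable {V : Type*} [AddCommGroup V] [Module F V]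

/-- The series with the exponents of the variable `i` lowered by one. -/
noncomputable def divVar (i : Fin 2) (f : BiSeries V) : BiSeries V :=
  fun d => f (d + Finsupp.single i 1)

theorem mulVar_add_single (i : Fin 2) (f : BiSeries V) (d : Fin 2 →₀ ℕ) :
    (mulVar F i f : BiSeries V) (d + Finsupp.single i 1) = f d := by
  change (if (d + Finsupp.single i 1 : Fin 2 →₀ ℕ) i = 0 then (0 : V) else
    f (d + Finsupp.single i 1 - Finsupp.single i 1)) = _
  rw [if_neg (by simp), add_tsub_cancel_right]

theorem mulVar_apply_eq_zero {i : Fin 2} (f : BiSeries V) {d : Fin 2 →₀ ℕ} (h : d i = 0) :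
    (mulVar F i f : BiSeries V) d = 0 := if_pos h

theorem mulVar_divVar {i : Fin 2} {f : BiSeries V} (h : ∀ d, d i = 0 → f d = 0) :
    mulVar F i (divVar i f) = f := by
  funext d
  by_cases hd : d i = 0
  · rw [mulVar_apply_eq_zero _ hd, h d hd]
  · obtain ⟨e, rfl⟩ : ∃ e, d = e + Finsupp.single i 1 :=
      ⟨d - Finsupp.single i 1, (tsub_add_cancel_of_le (Finsupp.single_le_iff.2
        (Nat.pos_of_ne_zero hd))).symm⟩
    exact mulVar_add_single i (divVar i f) e

end MulVar

theorem mem_map_mulVar {P : Submodule F 𝔤} {i : Fin 2} {f : BiSeries 𝔤} :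
    f ∈ (inside P).map (mulVar F i) ↔ f ∈ inside P ∧ ∀ d, d i = 0 → f d = 0 := by
  constructor
  · rintro ⟨g, hg, rfl⟩
    refine ⟨fun d => ?_, fun d => mulVar_apply_eq_zero g⟩
    change (if d i = 0 then (0 : 𝔤) else g _) ∈ P
    split_ifs
    · exact P.zero_mem
    · exact hg _
  · rintro ⟨hf, h⟩
    exact ⟨_, fun d => hf _, mulVar_divVar h⟩

theorem restrict_eq_zero_iff {V : Type*} [Zero V] {i : Fin 2} {f : BiSeries V} :
    restrict i f = 0 ↔ ∀ d, d i = 0 → f d = 0 := by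
  constructor
  · intro h d hd
    have := congrFun h d
    rwa [restrict, if_pos hd] at this
  · intro h
    funext d
    by_cases hd : d i = 0
    · rw [restrict, if_pos hd, h d hd]; rfl
    · rw [restrict, if_neg hd]; rfl

/-- A factorization in the opposite order has factors that are divisible by the same variables and
agree with the given factors where the other variable is zero. -/
theorem exists_lieExp_swap [CharZero F] {P Q : Submodule F 𝔤} (hPQ : IsCompl P Q) (i j : Fin 2)
    {x y : BiSeries 𝔤} (hx : x ∈ (inside Q).map (mulVar F j))
    (hy : y ∈ (inside P).map (mulVar F i)) :
    ∃ a ∈ (inside P).map (mulVar F i), ∃ b ∈ (inside Q).map (mulVar F j),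
      lieExp F x * lieExp F y = lieExp F a * lieExp F b ∧
      (∀ d, d j = 0 → a d = y d) ∧ ∀ d, d i = 0 → b d = x d := by
  rw [mem_map_mulVar] at hx hy
  obtain ⟨hxQ, hx⟩ := hx
  obtain ⟨hyP, hy⟩ := hy
  obtain ⟨a, ha, b, hb, ha0, hb0, h⟩ := exists_lieExp_factorization hPQ (hx 0 rfl) (hy 0 rfl)
  have hr0 : ∀ (k : Fin 2) {f : BiSeries 𝔤}, f 0 = 0 → restrict k f 0 = 0 := fun k f hf => by
    rw [restrict, if_pos (Finsupp.zero_apply), hf]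
  have hi := congrArg (restrict i) h
  have hj := congrArg (restrict j) h
  rw [restrict_mul, restrict_mul, restrict_lieExp, restrict_lieExp, restrict_lieExp,
    restrict_lieExp] at hi hj
  -- The factor that became 1 is written as e^0 on the side that makes both products factorizations
  -- in the same order, so that uniqueness applies.
  rw [restrict_eq_zero_iff.2 hy, lieExp_zero, mul_one, ← one_mul (lieExp F (restrict i x)),
    ← lieExp_zero] at hi
  rw [restrict_eq_zero_iff.2 hx, lieExp_zero, one_mul, ← mul_one (lieExp F (restrict j y)),
    ← lieExp_zero] at hj
  obtain ⟨h1, h2⟩ := lieExp_factorization_unique hPQ.disjoint (zero_mem _)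
    (restrict_mem_inside i hxQ) (restrict_mem_inside i ha) (restrict_mem_inside i hb) rfl
    (hr0 i (hx 0 rfl)) (hr0 i ha0) (hr0 i hb0) hi
  obtain ⟨h3, h4⟩ := lieExp_factorization_unique hPQ.disjoint (restrict_mem_inside j hyP)
    (zero_mem _) (restrict_mem_inside j ha) (restrict_mem_inside j hb) (hr0 j (hy 0 rfl)) rfl
    (hr0 j ha0) (hr0 j hb0) hj
  have hr : ∀ {k : Fin 2} {f g : BiSeries 𝔤}, restrict k f = restrict k g →
      ∀ d, d k = 0 → g d = f d := by
    intro k f g hfg d hd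
    have := congrFun hfg d
    rw [restrict, restrict, if_pos hd, if_pos hd] at this
    exact this.symm
  exact ⟨a, mem_map_mulVar.2 ⟨ha, restrict_eq_zero_iff.1 h1.symm⟩, b,
    mem_map_mulVar.2 ⟨hb, restrict_eq_zero_iff.1 h4.symm⟩, h, hr h3, hr h2⟩

/-! ### The lowest mixed coefficient -/

/-- The exponential of a multiple of a variable, to first order in that variable. -/
theorem exp_apply_of_le_one {A : Type*} [Ring A] [Algebra F A] {i : Fin 2} {x : BiSeries A}
    (hx : ∀ d, d i = 0 → x d = 0) {d : Fin 2 →₀ ℕ} (hd : d i ≤ 1) :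
    exp F x d = (1 + x) d := by
  have hpow : ∀ n, ∀ d : Fin 2 →₀ ℕ, d i < n → (x ^ n) d = 0 := by
    intro n
    induction n with
    | zero => intro d hd; omega
    | succ n ih =>
      intro d hd
      rw [pow_succ, mul_apply]
      refine sum_eq_zero fun p hp => ?_
      rw [← HasAntidiagonal.mem_antidiagonal.1 hp, Finsupp.add_apply] at hd
      rcases lt_or_ge (p.1 i) n with h | h
      · rw [ih _ h, zero_mul]
      · rw [hx p.2 (by omega), mul_zero]
  have h0 : (∑ k ∈ range d.degree, ((k + 1 + 1).factorial : F)⁻¹ • x ^ (k + 1 + 1)) d = 0 := by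
    rw [sum_apply']
    exact sum_eq_zero fun k _ => by rw [smul_apply', hpow _ _ (by omega), smul_zero]
  rw [exp_apply_eq_sum (hx 0 rfl) d (N := d.degree + 2) (by omega), sum_range_succ',
    sum_range_succ', add_apply', add_apply', h0, add_apply', zero_add, add_comm]
  simp

/-- The lowest mixed coefficient of a product of exponentials. -/
theorem exp_mul_exp_apply {A : Type*} [Ring A] [Algebra F A] {i j : Fin 2} (hij : i ≠ j)
    {x y : BiSeries A} (hx : ∀ d, d j = 0 → x d = 0) (hy : ∀ d, d i = 0 → y d = 0) :
    (exp F x * exp F y) (Finsupp.single i 1 + Finsupp.single j 1) =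
      x (Finsupp.single i 1 + Finsupp.single j 1) + y (Finsupp.single i 1 + Finsupp.single j 1) +
        x (Finsupp.single j 1) * y (Finsupp.single i 1) := by
  set m : Fin 2 →₀ ℕ := Finsupp.single i 1 + Finsupp.single j 1 with hm
  have hmi : m i = 1 := by simp [hm, hij.symm]
  have hmj : m j = 1 := by simp [hm, hij]
  -- Both exponents in `m` are one, so each exponential may be replaced by its first-order part.
  have h1 : (exp F x * exp F y) m = ((1 + x) * (1 + y)) m := by
    rw [mul_apply, mul_apply]
    refine sum_congr rfl fun p hp => ?_
    have hp' := HasAntidiagonal.mem_antidiagonal.1 hp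
    have hpi := DFunLike.congr_fun hp' i
    have hpj := DFunLike.congr_fun hp' j
    rw [Finsupp.add_apply] at hpi hpj
    rw [exp_apply_of_le_one hx (by omega), exp_apply_of_le_one hy (by omega)]
  have h2 : (x * y) m = x (Finsupp.single j 1) * y (Finsupp.single i 1) := by
    rw [mul_apply]
    refine sum_eq_single_of_mem (Finsupp.single j 1, Finsupp.single i 1)
      (HasAntidiagonal.mem_antidiagonal.2 (add_comm _ _)) fun p hp hne => ?_
    by_cases hj : p.1 j = 0
    · rw [hx _ hj, zero_mul]
    by_cases hi : p.2 i = 0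
    · rw [hy _ hi, mul_zero]
    have hp' := HasAntidiagonal.mem_antidiagonal.1 hp
    have hpi := DFunLike.congr_fun hp' i
    have hpj := DFunLike.congr_fun hp' j
    rw [Finsupp.add_apply] at hpi hpj
    have hk : ∀ k : Fin 2, k = i ∨ k = j := by omega
    refine absurd (Prod.ext (Finsupp.ext fun k => ?_) (Finsupp.ext fun k => ?_)) hne
    · rcases hk k with rfl | rfl
      · rw [Finsupp.single_eq_of_ne hij]; omega
      · rw [Finsupp.single_eq_same]; omega
    · rcases hk k with rfl | rfl
      · rw [Finsupp.single_eq_same]; omega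
      · rw [Finsupp.single_eq_of_ne hij.symm]; omega
  have h3 : (1 : BiSeries A) m = 0 := by
    refine (MvPowerSeries.coeff_one m).trans (if_neg fun h => ?_)
    rw [h] at hmi
    exact zero_ne_one hmi
  rw [h1, add_mul, one_mul, mul_add, mul_one, add_apply', add_apply', add_apply', h2, h3]
  abel

/-- The products of linear coefficients on the two sides contain the same two elements in opposite
orders, as `a` agrees with `y` and `b` with `x` there; their difference is the bracket. -/
theorem lieExp_swap_apply [CharZero F] {i j : Fin 2} (hij : i ≠ j) {x y a b : BiSeries 𝔤}
    (hx : ∀ d, d j = 0 → x d = 0) (hy : ∀ d, d i = 0 → y d = 0)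
    (ha : ∀ d, d i = 0 → a d = 0) (hb : ∀ d, d j = 0 → b d = 0)
    (hay : ∀ d, d j = 0 → a d = y d) (hbx : ∀ d, d i = 0 → b d = x d)
    (h : lieExp F x * lieExp F y = lieExp F a * lieExp F b) :
    a (Finsupp.single i 1 + Finsupp.single j 1) + b (Finsupp.single i 1 + Finsupp.single j 1) =
      x (Finsupp.single i 1 + Finsupp.single j 1) + y (Finsupp.single i 1 + Finsupp.single j 1) +
        ⁅x (Finsupp.single j 1), y (Finsupp.single i 1)⁆ := by
  let _ : LieRing (UniversalEnvelopingAlgebra F 𝔤) := LieRing.ofAssociativeRing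
  have hι : ∀ {k : Fin 2} {f : BiSeries 𝔤}, (∀ d, d k = 0 → f d = 0) →
      ∀ d, d k = 0 → mapCoeff (UniversalEnvelopingAlgebra.ι F) f d = 0 := by
    intro k f hf d hd
    change UniversalEnvelopingAlgebra.ι F (f d) = 0
    rw [hf d hd, map_zero]
  have h1 := congrFun h (Finsupp.single i 1 + Finsupp.single j 1)
  rw [lieExp, lieExp, lieExp, lieExp, exp_mul_exp_apply hij (hι hx) (hι hy), add_comm,
    add_comm (Finsupp.single i 1), exp_mul_exp_apply hij.symm (hι ha) (hι hb),
    add_comm (Finsupp.single j 1)] at h1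
  simp only [mapCoeff] at h1
  rw [hay _ (Finsupp.single_eq_of_ne hij.symm), hbx _ (Finsupp.single_eq_of_ne hij)] at h1
  refine UniversalEnvelopingAlgebra.ι_injective (F := F) ?_
  rw [map_add, map_add, map_add, LieHom.map_lie, LieRing.of_associative_ring_bracket,
    ← add_sub_assoc, eq_sub_iff_add_eq, ← h1]
  abel

end BiSeries

end

/-! ### The bijection and its terms of lowest order -/

theorem corollary3p9 {F : Type*} [Field F] [CharZero F] {𝔤 : Type*} [LieRing 𝔤] [LieAlgebra F 𝔤]
    (gm gp : Submodule F 𝔤) (hg : IsCompl gm gp) :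
    ∃ Ψ : BiSeries.tInside gp × BiSeries.sInside gm → BiSeries.sInside gm × BiSeries.tInside gp,
      Function.Bijective Ψ ∧
      (∀ p, BiSeries.lieExp F (p.1 : BiSeries 𝔤) * BiSeries.lieExp F (p.2 : BiSeries 𝔤) =
        BiSeries.lieExp F ((Ψ p).1 : BiSeries 𝔤) * BiSeries.lieExp F ((Ψ p).2 : BiSeries 𝔤)) ∧
      -- uniqueness, even among all maps that satisfy the equation
      (∀ Φ : BiSeries.tInside gp × BiSeries.sInside gm →
          BiSeries.sInside gm × BiSeries.tInside gp,
        (∀ p, BiSeries.lieExp F (p.1 : BiSeries 𝔤) * BiSeries.lieExp F (p.2 : BiSeries 𝔤) =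
          BiSeries.lieExp F ((Φ p).1 : BiSeries 𝔤) * BiSeries.lieExp F ((Φ p).2 : BiSeries 𝔤)) →
        Φ = Ψ) ∧
      -- the terms of lowest order
      (∀ (ap : BiSeries 𝔤) (hap : ap ∈ BiSeries.inside gp)
          (am : BiSeries 𝔤) (ham : am ∈ BiSeries.inside gm),
        ∃ Ψm ∈ BiSeries.inside gm, ∃ Ψp ∈ BiSeries.inside gp,
        ∃ Pm ∈ BiSeries.inside gm, ∃ Pp ∈ BiSeries.inside gp,
          BiSeries.sMul F Ψm = (Ψ (⟨BiSeries.tMul F ap, Submodule.mem_map_of_mem hap⟩,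
            ⟨BiSeries.sMul F am, Submodule.mem_map_of_mem ham⟩)).1 ∧
          BiSeries.tMul F Ψp = (Ψ (⟨BiSeries.tMul F ap, Submodule.mem_map_of_mem hap⟩,
            ⟨BiSeries.sMul F am, Submodule.mem_map_of_mem ham⟩)).2 ∧
          Ψm = am + BiSeries.tMul F
              (BiSeries.mapCoeff (gm.projection gp hg) (BiSeries.bracket ap am)) +
            BiSeries.tMul F Pm ∧
          Ψp = ap + BiSeries.sMul F
              (BiSeries.mapCoeff (gp.projection gm hg.symm) (BiSeries.bracket ap am)) +
            BiSeries.sMul F Pp ∧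
          Pm 0 = 0 ∧ Pp 0 = 0) := by
  have hex := fun p : BiSeries.tInside gp × BiSeries.sInside gm =>
    BiSeries.exists_lieExp_swap hg 0 1 p.1.2 p.2.2
  choose fa hfa fb hfb hmul hay hbx using hex
  -- Stated for arbitrary subspaces and variables, since the two orders of the factors are both
  -- needed.
  have huniq : ∀ {P Q : Submodule F 𝔤} {i j : Fin 2} (_ : Disjoint P Q)
      {p q : (BiSeries.inside P).map (BiSeries.mulVar F i) ×
        (BiSeries.inside Q).map (BiSeries.mulVar F j)},
      BiSeries.lieExp F (p.1 : BiSeries 𝔤) * BiSeries.lieExp F (p.2 : BiSeries 𝔤) =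
        BiSeries.lieExp F (q.1 : BiSeries 𝔤) * BiSeries.lieExp F (q.2 : BiSeries 𝔤) → p = q := by
    intro P Q i j hPQ p q h
    have h1 := BiSeries.mem_map_mulVar.1 p.1.2
    have h2 := BiSeries.mem_map_mulVar.1 p.2.2
    have h3 := BiSeries.mem_map_mulVar.1 q.1.2
    have h4 := BiSeries.mem_map_mulVar.1 q.2.2
    have h5 := BiSeries.lieExp_factorization_unique hPQ h1.1 h2.1 h3.1 h4.1 (h1.2 0 rfl)
      (h2.2 0 rfl) (h3.2 0 rfl) (h4.2 0 rfl) h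
    exact Prod.ext (Subtype.ext h5.1) (Subtype.ext h5.2)
  refine ⟨fun p => (⟨fa p, hfa p⟩, ⟨fb p, hfb p⟩), ⟨fun p q hpq => ?_, fun q => ?_⟩, hmul,
    fun Φ hΦ => funext fun p => huniq hg.disjoint ((hΦ p).symm.trans (hmul p)), ?_⟩
  · refine huniq hg.disjoint.symm ((hmul p).trans (Eq.trans ?_ (hmul q).symm))
    rw [show fa p = fa q from congrArg (fun r => (r.1 : BiSeries 𝔤)) hpq,
      show fb p = fb q from congrArg (fun r => (r.2 : BiSeries 𝔤)) hpq]
  -- A preimage is the factorization in the opposite order, with the roles of subspaces and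
  -- variables exchanged.
  · obtain ⟨a, ha, b, hb, h, -⟩ := BiSeries.exists_lieExp_swap hg.symm 1 0 q.1.2 q.2.2
    exact ⟨(⟨a, ha⟩, ⟨b, hb⟩), huniq hg.disjoint ((hmul (⟨a, ha⟩, ⟨b, hb⟩)).symm.trans h.symm)⟩
  · intro ap hap am ham
    set p : BiSeries.tInside gp × BiSeries.sInside gm :=
      (⟨BiSeries.tMul F ap, Submodule.mem_map_of_mem hap⟩,
        ⟨BiSeries.sMul F am, Submodule.mem_map_of_mem ham⟩) with hp
    obtain ⟨ha, ha0⟩ := BiSeries.mem_map_mulVar.1 (hfa p)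
    obtain ⟨hb, hb0⟩ := BiSeries.mem_map_mulVar.1 (hfb p)
    have hx0 := (BiSeries.mem_map_mulVar.1 p.1.2).2
    have hy0 := (BiSeries.mem_map_mulVar.1 p.2.2).2
    have hst := BiSeries.lieExp_swap_apply (by decide) hx0 hy0 ha0 hb0 (hay p) (hbx p) (hmul p)
    have hxs : ∀ d, (p.1 : BiSeries 𝔤) (d + Finsupp.single 1 1) = ap d :=
      BiSeries.mulVar_add_single 1 ap
    have hys : ∀ d, (p.2 : BiSeries 𝔤) (d + Finsupp.single 0 1) = am d :=
      BiSeries.mulVar_add_single 0 am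
    have hx1 : (p.1 : BiSeries 𝔤) (Finsupp.single 1 1) = ap 0 := by rw [← hxs 0, zero_add]
    have hy1 : (p.2 : BiSeries 𝔤) (Finsupp.single 0 1) = am 0 := by rw [← hys 0, zero_add]
    rw [hx1, hy1, hxs, add_comm (Finsupp.single (0 : Fin 2) 1), hys] at hst
    -- At t = 0 the new factor equals the old one, so their difference is divisible by t as well as
    -- by s.
    have hm : ∀ d : Fin 2 →₀ ℕ, d 1 = 0 → (BiSeries.divVar 0 (fa p) - am) d = 0 := by
      intro d hd
      change fa p (d + Finsupp.single 0 1) - am d = 0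
      rw [hay p _ (by simp [hd]), hys, sub_self]
    have hp' : ∀ d : Fin 2 →₀ ℕ, d 0 = 0 → (BiSeries.divVar 1 (fb p) - ap) d = 0 := by
      intro d hd
      change fb p (d + Finsupp.single 1 1) - ap d = 0
      rw [hbx p _ (by simp [hd]), hxs, sub_self]
    -- Each remainder is the quotient of this difference by st, less the projected bracket; its
    -- constant term is a projection of `hst`.
    refine ⟨BiSeries.divVar 0 (fa p), fun d => ha _, BiSeries.divVar 1 (fb p), fun d => hb _,
      BiSeries.divVar 1 (BiSeries.divVar 0 (fa p) - am) -
        BiSeries.mapCoeff (gm.projection gp hg) (BiSeries.bracket ap am),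
      fun d => gm.sub_mem (gm.sub_mem (ha _) (ham _)) (Submodule.projection_apply_mem hg _),
      BiSeries.divVar 0 (BiSeries.divVar 1 (fb p) - ap) -
        BiSeries.mapCoeff (gp.projection gm hg.symm) (BiSeries.bracket ap am),
      fun d => gp.sub_mem (gp.sub_mem (hb _) (hap _)) (Submodule.projection_apply_mem hg.symm _),
      BiSeries.mulVar_divVar ha0, BiSeries.mulVar_divVar hb0, ?_, ?_, ?_, ?_⟩
    · rw [map_sub (BiSeries.tMul F), BiSeries.tMul, BiSeries.mulVar_divVar hm]
      abel
    · rw [map_sub (BiSeries.sMul F), BiSeries.sMul, BiSeries.mulVar_divVar hp']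
      abel
    · change fa p (0 + Finsupp.single 1 1 + Finsupp.single 0 1) - am (0 + Finsupp.single 1 1) -
        gm.projection gp hg (BiSeries.bracket ap am 0) = 0
      have h := congrArg (gm.projection gp hg) hst
      simp only [map_add] at h
      rw [Submodule.projection_apply_of_mem_left hg (ha _),
        Submodule.projection_apply_of_mem_right hg (hb _),
        Submodule.projection_apply_of_mem_right hg (hap _),
        Submodule.projection_apply_of_mem_left hg (ham _), add_zero, zero_add] at h
      rw [BiSeries.bracket_apply_zero, zero_add, h]
      abel
    · change fb p (0 + Finsupp.single 0 1 + Finsupp.single 1 1) - ap (0 + Finsupp.single 0 1) -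
        gp.projection gm hg.symm (BiSeries.bracket ap am 0) = 0
      have h := congrArg (gp.projection gm hg.symm) hst
      simp only [map_add] at h
      rw [Submodule.projection_apply_of_mem_right hg.symm (ha _),
        Submodule.projection_apply_of_mem_left hg.symm (hb _),
        Submodule.projection_apply_of_mem_left hg.symm (hap _),
        Submodule.projection_apply_of_mem_right hg.symm (ham _), add_zero, zero_add] at h
      rw [BiSeries.bracket_apply_zero, zero_add, add_comm (Finsupp.single (0 : Fin 2) 1), h]
      abel
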